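/- **Corollary (lower bound for CDCL, and optimality of the exponent).** *Setting.* A clause is a finite set of literals, a CNF formula is a finite set of clauses, and a $3$-CNF formula is one whose clauses have at most $3$ literals each. A resolution refutation of $F$ is a sequence of clauses ending in the empty clause in which every clause is a clause of $F$, or is $A\vee B$ for two earlier clauses $A\vee x$ and $B\vee\overline{x}$, or contains an earlier clause. Its width is the largest number of literals in one of its clauses. "$F$ is refutable in width $w$" means that $F$ has a resolution refutation of width at most $w$, and "$F$ is over $n$ variables" means that its variables are among $n$ given ones. A resolution-based CDCL solver is a (deterministic or randomized) procedure that maintains the input formula, a set of learned clauses (initially empty) and a trail (initially empty) of decision literals and unit-propagated literals, the latter with their reason clauses. In each unit of time it performs at most one elementary CDCL operation: decide a literal on an unassigned variable; propagate a literal by a clause, of the formula or learned, that is unit under the trail; start conflict analysis at such a clause that is falsified by the trail; resolve the clause under conflict analysis with the reason of a propagated literal of the trail; learn the clause under conflict analysis; leave conflict analysis and undo a most recent part of the trail (backjump); restart (undo all or a most recent part of the trail); delete learned clauses. All heuristics and policies are arbitrary. It may answer "unsatisfiable" only when there is a conflict and the trail contains no decision, or when conflict analysis has reached the empty clause. *Statement.*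 1. For every real $a<1/2$ there are constants $c>0$, $K$ and $n_0$ such that for all integers $n\ge n_0$ and $w$ with $2\le w\le n^{a}$ there is a $3$-CNF formula $F$ over $n$ variables with at most $K\,w\,n$ clauses that is refutable in resolution in width $w$, and for which every execution of every resolution-based CDCL solver that ends with the answer "unsatisfiable" takes time at least $n^{c w}$. 2. Hence the upper bound $n^{O(w)}$ of Atserias, Fichte and Thurley on the time that CDCL solvers need on formulas over $n$ variables refutable in width $w$ is optimal up to constants in the exponent: there is a constant $c>0$ such that for every integer $w\ge 2$, every resolution-based CDCL solver and all reals $K,g$, if for all sufficiently large $n$ and every $3$-CNF formula $F$ over $n$ variables refutable in width $w$ some execution of the solver on $F$ answers "unsatisfiable" within time $K n^{g}$, then $g\ge c\,w$. -/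

import Mathlib

/-! ### Clauses, CNF formulas, resolution -/

/-- A literal over the variables `V`: `(x, true)` is the literal `x`, `(x, false)` its negation. -/
abbrev Literal (V : Type) := V × Bool

/-- The complementary literal. -/
def Literal.neg {V : Type} (l : Literal V) : Literal V := (l.1, !l.2)

/-- A clause is a finite set of literals, read as their disjunction. -/
abbrev Clause (V : Type) := Finset (Literal V)

/-- A CNF formula is a finite set of clauses, read as their conjunction. -/
abbrev CNF (V : Type) := Finset (Clause V)

/-- A `k`-CNF formula: every clause has at most `k` literals. -/
def CNF.IsKCNF {V : Type} (F : CNF V) (k : ℕ) : Prop := ∀ C ∈ F, C.card ≤ k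

/-- The sequence of clauses `π` is a resolution refutation of `F`: it ends in the empty clause, and
every clause is an axiom, or is `A ∨ B` for two earlier clauses `A ∨ x` and `B ∨ ¬x`,
or is a weakening of an earlier clause. -/
def IsResolutionRefutation {V : Type} [DecidableEq V] (F : CNF V) (π : List (Clause V)) : Prop :=
  (∀ t : Fin π.length,
    π.get t ∈ F ∨
    (∃ i j : Fin π.length, i < t ∧ j < t ∧ ∃ (x : V) (A B : Clause V),
      π.get i = insert (x, true) A ∧ π.get j = insert (x, false) B ∧ π.get t = A ∪ B) ∨
    (∃ i : Fin π.length, i < t ∧ π.get i ⊆ π.get t)) ∧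
  π.getLast? = some ∅

/-- `F` has a resolution refutation in which every clause has at most `w` literals. -/
def RefutableInWidth {V : Type} [DecidableEq V] (F : CNF V) (w : ℕ) : Prop :=
  ∃ π : List (Clause V), IsResolutionRefutation F π ∧ ∀ C ∈ π, C.card ≤ w

/-! ### Conflict-driven clause learning -/

/-- An entry of the trail (the current partial assignment): a literal made true either by a
decision or by unit propagation; in the latter case the clause that became unit is recorded. -/
inductive TrailEntry (V : Type) where
  | decision (l : Literal V)
  | propagated (l : Literal V) (reason : Clause V)

/-- The literal that a trail entry makes true. -/
def TrailEntry.lit {V : Type} : TrailEntry V → Literal V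
  | .decision l => l
  | .propagated l _ => l

/-- The trail; the most recent entry is the head of the list. -/
abbrev Trail (V : Type) := List (TrailEntry V)

/-- The literal `l` is true under the trail. -/
def Trail.IsTrue {V : Type} (t : Trail V) (l : Literal V) : Prop := ∃ e ∈ t, e.lit = l

/-- The literal `l` is false under the trail. -/
def Trail.IsFalse {V : Type} (t : Trail V) (l : Literal V) : Prop := t.IsTrue l.neg

/-- The variable of `l` has no value under the trail. -/
def Trail.Unassigned {V : Type} (t : Trail V) (l : Literal V) : Prop :=
  ¬ t.IsTrue l ∧ ¬ t.IsFalse l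

/-- The decision level is zero: the trail has no decisions. -/
def Trail.IsLevelZero {V : Type} (t : Trail V) : Prop :=
  ∀ e ∈ t, ∀ l : Literal V, e ≠ TrailEntry.decision l

/-- A CDCL solver either searches (extends the trail), or analyses a conflict; in the second case
it holds the clause, falsified by the trail, that conflict analysis has reached so far. -/
inductive CDCLMode (V : Type) where
  | searching
  | analyzing (D : Clause V)

/-- The state of the CDCL search: the input formula, the learned clauses that are currently stored,
the trail and the mode. -/
structure CDCLState (V : Type) where
  formula : CNF V
  learned : Finset (Clause V)
  trail : Trail V
  mode : CDCLMode V

/-- The initial state on input `F`. -/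
def CDCLState.initial {V : Type} (F : CNF V) : CDCLState V := ⟨F, ∅, [], .searching⟩

/-- The elementary operations of conflict-driven clause learning. Which of the applicable ones is
carried out (decision heuristic, propagation order, learning scheme, backjumping, restart policy,
clause deletion policy) is left open, so that every such solver is covered. -/
inductive CDCLStep {V : Type} [DecidableEq V] : CDCLState V → CDCLState V → Prop where
  /-- Assign a literal whose variable has no value. -/
  | decide (F : CNF V) (L : Finset (Clause V)) (t : Trail V) (l : Literal V) (hl : t.Unassigned l) :
      CDCLStep ⟨F, L, t, .searching⟩ ⟨F, L, .decision l :: t, .searching⟩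
  /-- Unit propagation: all literals of the clause `C` but `l` are false, so `l` is set to true. -/
  | propagate (F : CNF V) (L : Finset (Clause V)) (t : Trail V) (l : Literal V) (C : Clause V)
      (hC : C ∈ F ∨ C ∈ L) (hlC : l ∈ C) (hl : t.Unassigned l)
      (hunit : ∀ l' ∈ C, l' ≠ l → t.IsFalse l') :
      CDCLStep ⟨F, L, t, .searching⟩ ⟨F, L, .propagated l C :: t, .searching⟩
  /-- Some clause is falsified: conflict analysis starts with this clause. -/
  | conflict (F : CNF V) (L : Finset (Clause V)) (t : Trail V) (C : Clause V)
      (hC : C ∈ F ∨ C ∈ L) (hfalse : ∀ l ∈ C, t.IsFalse l) :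
      CDCLStep ⟨F, L, t, .searching⟩ ⟨F, L, t, .analyzing C⟩
  /-- One step of conflict analysis: resolve with the reason of a propagated literal. -/
  | resolve (F : CNF V) (L : Finset (Clause V)) (t : Trail V) (D : Clause V) (l : Literal V)
      (C : Clause V) (he : TrailEntry.propagated l C ∈ t) (hl : l.neg ∈ D) :
      CDCLStep ⟨F, L, t, .analyzing D⟩ ⟨F, L, t, .analyzing (D.erase l.neg ∪ C.erase l)⟩
  /-- Learn the clause that conflict analysis has reached. -/
  | learn (F : CNF V) (L : Finset (Clause V)) (t : Trail V) (D : Clause V) :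
      CDCLStep ⟨F, L, t, .analyzing D⟩ ⟨F, insert D L, t, .analyzing D⟩
  /-- Leave conflict analysis and undo the most recent part of the trail. -/
  | backjump (F : CNF V) (L : Finset (Clause V)) (t t' : Trail V) (D : Clause V) (ht : t' <:+ t) :
      CDCLStep ⟨F, L, t, .analyzing D⟩ ⟨F, L, t', .searching⟩
  /-- A complete (`t' = []`) or partial restart. -/
  | restart (F : CNF V) (L : Finset (Clause V)) (t t' : Trail V) (ht : t' <:+ t) :
      CDCLStep ⟨F, L, t, .searching⟩ ⟨F, L, t', .searching⟩
  /-- Delete some of the learned clauses. -/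
  | forget (F : CNF V) (L L' : Finset (Clause V)) (t : Trail V) (m : CDCLMode V) (hL : L' ⊆ L) :
      CDCLStep ⟨F, L, t, m⟩ ⟨F, L', t, m⟩

/-- The search has established unsatisfiability: there is a conflict at decision level zero, or
conflict analysis has reached the empty clause. -/
def CDCLState.IsRefuted {V : Type} (s : CDCLState V) : Prop :=
  ∃ D : Clause V, s.mode = .analyzing D ∧ (D = ∅ ∨ s.trail.IsLevelZero)

/-- A (resolution-based) CDCL solver. Its configurations comprise a CDCL state and arbitrary further
data (heuristic scores, watch lists, random bits, ...). One unit of time is enough for at most one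
elementary CDCL operation. Several configurations may be possible after one step, since the
choices of the solver may be random. -/
structure CDCLSolver (V : Type) [DecidableEq V] where
  /-- The configurations. -/
  Config : Type
  /-- The CDCL state that is part of a configuration. -/
  state : Config → CDCLState V
  /-- The possible configurations in which the solver starts on an input formula. -/
  start : CNF V → Set Config
  /-- The possible configurations after one more unit of time. -/
  next : Config → Set Config
  /-- The configurations in which the solver has answered that the input is unsatisfiable. -/
  unsat : Set Config
  state_start : ∀ F, ∀ c ∈ start F, state c = CDCLState.initial F
  state_next : ∀ c, ∀ c' ∈ next c, state c' = state c ∨ CDCLStep (state c) (state c')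
  state_unsat : ∀ c ∈ unsat, (state c).IsRefuted

/-- Some execution of the solver on `F` takes time `T` and ends with the answer that `F` is
unsatisfiable. -/
def CDCLSolver.CanRefuteInTime {V : Type} [DecidableEq V] (S : CDCLSolver V) (F : CNF V) (T : ℕ) :
    Prop :=
  ∃ c : ℕ → S.Config, c 0 ∈ S.start F ∧ (∀ i < T, c (i + 1) ∈ S.next (c i)) ∧ c T ∈ S.unsat

/-! A CDCL run is a resolution derivation in disguise. Each operation uses at most one new clause,
and a conflict without decisions is turned into the empty clause by resolving backwards along the
trail, once per entry. So time `T` yields a refutation with at most `2 * T` distinct clauses,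
whatever the heuristics (`CDCLStep.sound`, `CDCLSolver.CanRefuteInTime.exists_derivation`). It
remains to find formulas with narrow refutations but no short ones.

For `w ≥ 8` these are pigeonhole formulas in which each of `h + 1` pigeons first selects one of `N`
copies of itself, and only selected copies must obey the `h` holes. A refutation of width `2 * h +
5` places the pigeons one by one, remembering a copy and a hole for each
(`relPHP.derivable_stateClause`).

The size bound `N ^ h / (h + 1)` comes from a random restriction: select a copy of each pigeon
uniformly, and give each other copy one random bit as the value of all its hole variables. What
remains is the pigeonhole principle, so every refutation has a clause that the bits do not satisfy
and that mentions the selected copies of at least `h` pigeons (`relPHP.exists_isWide`). For a fixed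
clause this is rare. If it mentions `m` copies of a pigeon, then one of them is selected and the
others escape satisfaction with probability at most `(m / N) * 2 ^ (1 - m) ≤ 1 / N`; independence
over the pigeons and a union bound over the omitted pigeon give `(h + 1) / N ^ h`
(`relPHP.card_isWide_le`).

With `h` about `w / 4` and `N` about `n ^ (1 / 2 - a)` the formula fits into `n` variables, and `N ^
h` is `n ^ (c * w)`. For `w < 8` a bound of order `√n` is enough, and a chain of implications
provides it. The second part compares the exponents for fixed `w` as `n` grows. -/

/-! ### Derivations all of whose clauses satisfy a given property -/

/-- `C` has a resolution derivation from `F` in which all clauses satisfy `P`. -/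
inductive DerivableWithin {V : Type} [DecidableEq V] (F : CNF V) (P : Clause V → Prop) :
    Clause V → Prop where
  | ax (C : Clause V) (hC : C ∈ F) (hP : P C) : DerivableWithin F P C
  | weaken (A C : Clause V) (hA : DerivableWithin F P A) (hAC : A ⊆ C) (hP : P C) :
      DerivableWithin F P C
  | res (x : V) (A B C : Clause V) (hA : DerivableWithin F P A) (hB : DerivableWithin F P B)
      (hAC : A.erase (x, true) ⊆ C) (hBC : B.erase (x, false) ⊆ C) (hP : P C) :
      DerivableWithin F P C

namespace DerivableWithin

variable {V : Type} [DecidableEq V] {F : CNF V} {P Q : Clause V → Prop}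

theorem mono (hPQ : ∀ C, P C → Q C) {C : Clause V} (h : DerivableWithin F P C) :
    DerivableWithin F Q C := by
  induction h with
  | ax C hC hP => exact .ax C hC (hPQ _ hP)
  | weaken A C _ hAC hP ih => exact .weaken A C ih hAC (hPQ _ hP)
  | res x A B C _ _ hAC hBC hP ihA ihB => exact .res x A B C ihA ihB hAC hBC (hPQ _ hP)

theorem resLit (l : Literal V) {A B C : Clause V} (hA : DerivableWithin F P A)
    (hB : DerivableWithin F P B) (hAC : A.erase l ⊆ C) (hBC : B.erase l.neg ⊆ C) (hP : P C) :
    DerivableWithin F P C := by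
  obtain ⟨x, b⟩ := l
  cases b
  · exact .res x B A C hB hA hBC hAC hP
  · exact .res x A B C hA hB hAC hBC hP

/-- Renaming (and possibly identifying) variables. -/
theorem map {W : Type} [DecidableEq W] (f : V → W) {Q : Clause W → Prop}
    (hPQ : ∀ C, P C → Q (C.image (Prod.map f id))) {C : Clause V} (h : DerivableWithin F P C) :
    DerivableWithin (F.image (fun C => C.image (Prod.map f id))) Q (C.image (Prod.map f id)) := by
  have key : ∀ (x : V) (b : Bool) (A C : Clause V), A.erase (x, b) ⊆ C →
      (A.image (Prod.map f id)).erase (f x, b) ⊆ C.image (Prod.map f id) := by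
    intro x b A C hAC l hl
    obtain ⟨hne, hl⟩ := Finset.mem_erase.1 hl
    obtain ⟨k, hk, rfl⟩ := Finset.mem_image.1 hl
    refine Finset.mem_image_of_mem _ (hAC (Finset.mem_erase.2 ⟨?_, hk⟩))
    rintro rfl
    exact hne rfl
  induction h with
  | ax C hC hP => exact .ax _ (Finset.mem_image_of_mem _ hC) (hPQ _ hP)
  | weaken A C _ hAC hP ih => exact .weaken _ _ ih (Finset.image_subset_image hAC) (hPQ _ hP)
  | res x A B C _ _ hAC hBC hP ihA ihB =>
    exact .res (f x) _ _ _ ihA ihB (key _ _ _ _ hAC) (key _ _ _ _ hBC) (hPQ _ hP)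

/-- Resolution is sound. -/
theorem sound (α : V → Bool) (hα : ∀ C ∈ F, ∃ l ∈ C, α l.1 = l.2) {C : Clause V}
    (h : DerivableWithin F P C) : ∃ l ∈ C, α l.1 = l.2 := by
  induction h with
  | ax C hC _ => exact hα C hC
  | weaken A C _ hAC _ ih => exact ih.imp fun l hl => ⟨hAC hl.1, hl.2⟩
  | res x A B C _ _ hAC hBC _ ihA ihB =>
    cases hx : α x
    · obtain ⟨l, hl, h⟩ := ihA
      refine ⟨l, hAC (Finset.mem_erase.2 ⟨?_, hl⟩), h⟩
      rintro rfl
      simp [hx] at h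
    · obtain ⟨l, hl, h⟩ := ihB
      refine ⟨l, hBC (Finset.mem_erase.2 ⟨?_, hl⟩), h⟩
      rintro rfl
      simp [hx] at h

/-- An axiom that does not satisfy `P` is not used. -/
theorem erase_input {A : Clause V} (hA : ¬ P A) {C : Clause V} (h : DerivableWithin F P C) :
    DerivableWithin (F.erase A) P C := by
  induction h with
  | ax C hC hP =>
    refine .ax C (Finset.mem_erase.2 ⟨?_, hC⟩) hP
    rintro rfl
    exact hA hP
  | weaken A C _ hAC hP ih => exact .weaken A C ih hAC hP
  | res x A B C _ _ hAC hBC hP ihA ihB => exact .res x A B C ihA ihB hAC hBC hP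

end DerivableWithin

/-- Every clause of the list is an axiom, or follows from earlier ones. -/
def IsResolutionDerivation {V : Type} [DecidableEq V] (F : CNF V) (π : List (Clause V)) : Prop :=
  ∀ t : Fin π.length,
    π.get t ∈ F ∨
    (∃ i j : Fin π.length, i < t ∧ j < t ∧ ∃ (x : V) (A B : Clause V),
      π.get i = insert (x, true) A ∧ π.get j = insert (x, false) B ∧ π.get t = A ∪ B) ∨
    (∃ i : Fin π.length, i < t ∧ π.get i ⊆ π.get t)

theorem IsResolutionDerivation.concat {V : Type} [DecidableEq V] {F : CNF V}
    {π : List (Clause V)} (hπ : IsResolutionDerivation F π) {C : Clause V}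
    (hC : C ∈ F ∨ (∃ (x : V) (A B : Clause V), insert (x, true) A ∈ π ∧ insert (x, false) B ∈ π ∧
      C = A ∪ B) ∨ ∃ A ∈ π, A ⊆ C) : IsResolutionDerivation F (π ++ [C]) := by
  have hlen : (π ++ [C]).length = π.length + 1 := by simp
  have hget : ∀ (i : ℕ) (hi : i < π.length), (π ++ [C]).get ⟨i, by omega⟩ = π.get ⟨i, hi⟩ := by
    intro i hi
    simp [List.getElem_append_left hi]
  rintro ⟨t, ht⟩
  rcases Nat.lt_or_ge t π.length with h | h
  · rw [hget t h]
    rcases hπ ⟨t, h⟩ with h1 | ⟨i, j, hi, hj, x, A, B, h1, h2, h3⟩ | ⟨i, hi, h1⟩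
    · exact Or.inl h1
    · exact Or.inr (Or.inl ⟨⟨i, by omega⟩, ⟨j, by omega⟩, hi, hj, x, A, B,
        by rw [hget i i.2, ← h1], by rw [hget j j.2, ← h2], h3⟩)
    · exact Or.inr (Or.inr ⟨⟨i, by omega⟩, hi, by rw [hget i i.2]; exact h1⟩)
  · obtain rfl : t = π.length := by omega
    have hl : (π ++ [C]).get ⟨π.length, ht⟩ = C := by simp
    rw [hl]
    rcases hC with h1 | ⟨x, A, B, h1, h2, h3⟩ | ⟨A, hA, h1⟩
    · exact Or.inl h1
    · obtain ⟨i, hi⟩ := List.get_of_mem h1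
      obtain ⟨j, hj⟩ := List.get_of_mem h2
      exact Or.inr (Or.inl ⟨⟨i, by omega⟩, ⟨j, by omega⟩, i.2, j.2, x, A, B,
        by rw [hget i i.2, ← hi], by rw [hget j j.2, ← hj], h3⟩)
    · obtain ⟨i, hi⟩ := List.get_of_mem hA
      exact Or.inr (Or.inr ⟨⟨i, by omega⟩, i.2, by rw [hget i i.2]; exact hi ▸ h1⟩)

/-- Both premises must end up in one list, hence the arbitrary initial list `π`. The rule `res`
includes weakening and does not require the pivot to occur: if it is missing from a premise, that
premise is weakened to `C`. -/
theorem DerivableWithin.exists_list {V : Type} [DecidableEq V] {F : CNF V} {w : ℕ} {C : Clause V}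
    (h : DerivableWithin F (fun C => C.card ≤ w) C) : ∀ π : List (Clause V),
      IsResolutionDerivation F π → (∀ A ∈ π, A.card ≤ w) →
      ∃ π' : List (Clause V), IsResolutionDerivation F π' ∧ (∀ A ∈ π', A.card ≤ w) ∧
        π ⊆ π' ∧ C ∈ π' := by
  have step : ∀ (π : List (Clause V)) (C : Clause V), (∀ A ∈ π, A.card ≤ w) → C.card ≤ w →
      ∀ A ∈ π ++ [C], A.card ≤ w := by
    intro π C h1 h2 A hA
    rcases List.mem_append.1 hA with h | h
    · exact h1 A h
    · rw [List.mem_singleton.1 h]; exact h2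
  induction h with
  | ax C hC hP =>
    intro π h1 h2
    exact ⟨π ++ [C], h1.concat (Or.inl hC), step _ _ h2 hP, by simp, by simp⟩
  | weaken A C _ hAC hP ih =>
    intro π h1 h2
    obtain ⟨π', h3, h4, h5, h6⟩ := ih π h1 h2
    exact ⟨π' ++ [C], h3.concat (Or.inr (Or.inr ⟨A, h6, hAC⟩)), step _ _ h4 hP,
      fun _ h => List.mem_append_left _ (h5 h), by simp⟩
  | res x A B C _ _ hAC hBC hP ihA ihB =>
    intro π h1 h2
    obtain ⟨π₁, h3, h4, h5, h6⟩ := ihA π h1 h2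
    obtain ⟨π₂, k3, k4, k5, k6⟩ := ihB π₁ h3 h4
    have hsub : π ⊆ π₂ := fun _ h => k5 (h5 h)
    by_cases hxA : (x, true) ∈ A
    · by_cases hxB : (x, false) ∈ B
      · have hR : A.erase (x, true) ∪ B.erase (x, false) ⊆ C := Finset.union_subset hAC hBC
        refine ⟨(π₂ ++ [A.erase (x, true) ∪ B.erase (x, false)]) ++ [C],
          (k3.concat (Or.inr (Or.inl ⟨x, _, _, ?_, ?_, rfl⟩))).concat
            (Or.inr (Or.inr ⟨_, by simp, hR⟩)),
          step _ _ (step _ _ k4 ((Finset.card_le_card hR).trans hP)) hP,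
          fun _ h => List.mem_append_left _ (List.mem_append_left _ (hsub h)), by simp⟩
        · rw [Finset.insert_erase hxA]; exact k5 h6
        · rw [Finset.insert_erase hxB]; exact k6
      · rw [Finset.erase_eq_of_notMem hxB] at hBC
        exact ⟨π₂ ++ [C], k3.concat (Or.inr (Or.inr ⟨B, k6, hBC⟩)), step _ _ k4 hP,
          fun _ h => List.mem_append_left _ (hsub h), by simp⟩
    · rw [Finset.erase_eq_of_notMem hxA] at hAC
      exact ⟨π₂ ++ [C], k3.concat (Or.inr (Or.inr ⟨A, k5 h6, hAC⟩)), step _ _ k4 hP,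
        fun _ h => List.mem_append_left _ (hsub h), by simp⟩

theorem DerivableWithin.refutableInWidth {V : Type} [DecidableEq V] {F : CNF V} {w : ℕ}
    (h : DerivableWithin F (fun C => C.card ≤ w) ∅) : RefutableInWidth F w := by
  obtain ⟨π, h1, h2, -, h3⟩ := h.exists_list [] (fun t => t.elim0) (by simp)
  refine ⟨π ++ [∅], ⟨h1.concat (Or.inr (Or.inr ⟨∅, h3, le_rfl⟩)), by simp⟩, ?_⟩
  intro A hA
  rcases List.mem_append.1 hA with h | h
  · exact h2 A h
  · simp [List.mem_singleton.1 h]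

/-! ### From runs of CDCL solvers to resolution derivations -/

section CDCL

variable {V : Type}

/-- The reason clause of every propagated literal satisfies `Q`, and all its other literals are
false under the earlier part of the trail. -/
def Trail.Justified (Q : Clause V → Prop) : Trail V → Prop
  | [] => True
  | .decision _ :: t => Trail.Justified Q t
  | .propagated l C :: t =>
      (Q C ∧ ∀ l' ∈ C, l' ≠ l → Trail.IsFalse t l') ∧ Trail.Justified Q t

theorem Trail.IsFalse.of_suffix {t t' : Trail V} (h : t' <:+ t) {l : Literal V}
    (hl : t'.IsFalse l) : t.IsFalse l := by
  obtain ⟨e, he, h1⟩ := hl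
  exact ⟨e, h.subset he, h1⟩

theorem Trail.Justified.of_suffix {Q : Clause V → Prop} {t t' : Trail V} (h : t' <:+ t)
    (ht : t.Justified Q) : t'.Justified Q := by
  induction t with
  | nil => rw [List.suffix_nil.1 h]; trivial
  | cons e t ih =>
    rcases List.suffix_cons_iff.1 h with rfl | h'
    · exact ht
    · cases e with
      | decision l => exact ih h' ht
      | propagated l C => exact ih h' ht.2

theorem Trail.Justified.mono {Q Q' : Clause V → Prop} (h : ∀ C, Q C → Q' C) {t : Trail V}
    (ht : t.Justified Q) : t.Justified Q' := by
  induction t with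
  | nil => trivial
  | cons e t ih =>
    cases e with
    | decision l => exact ih ht
    | propagated l C => exact ⟨⟨h _ ht.1.1, ht.1.2⟩, ih ht.2⟩

theorem Trail.Justified.of_mem {Q : Clause V → Prop} {t : Trail V} (ht : t.Justified Q)
    {l : Literal V} {C : Clause V} (he : TrailEntry.propagated l C ∈ t) :
    Q C ∧ ∀ l' ∈ C, l' ≠ l → t.IsFalse l' := by
  obtain ⟨t₁, t₂, rfl⟩ := List.append_of_mem he
  have h := (ht.of_suffix (List.suffix_append t₁ _)).1
  exact ⟨h.1, fun l' h1 h2 =>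
    (h.2 l' h1 h2).of_suffix ((List.suffix_cons _ _).trans (List.suffix_append t₁ _))⟩

/-- All clauses of a state satisfy `Q`, and the clause under conflict analysis is falsified. -/
structure CDCLState.Sound (F : CNF V) (Q : Clause V → Prop) (s : CDCLState V) : Prop where
  formula : s.formula = F
  learned : ∀ C ∈ s.learned, Q C
  trail : s.trail.Justified Q
  mode : ∀ D, s.mode = .analyzing D → Q D ∧ ∀ l ∈ D, s.trail.IsFalse l

theorem CDCLState.Sound.mono {F : CNF V} {Q Q' : Clause V → Prop} (h : ∀ C, Q C → Q' C)
    {s : CDCLState V} (hs : s.Sound F Q) : s.Sound F Q' :=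
  ⟨hs.formula, fun C hC => h C (hs.learned C hC), hs.trail.mono h,
    fun D hD => ⟨h D (hs.mode D hD).1, (hs.mode D hD).2⟩⟩

variable [DecidableEq V]

theorem DerivableWithin.mono_finset {F : CNF V} {P Q : Finset (Clause V)} (h : P ⊆ Q)
    (C : Clause V) (hC : DerivableWithin F (· ∈ P) C) : DerivableWithin F (· ∈ Q) C :=
  hC.mono fun _ hD => h hD

/-- A learned clause is already derivable within `P`; only a formula clause has to be paid for.
Inserting `C` covers both cases. -/
theorem DerivableWithin.insert_input {F : CNF V} {P L : Finset (Clause V)} {C : Clause V}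
    (hC : C ∈ F ∨ C ∈ L) (hL : ∀ C ∈ L, DerivableWithin F (· ∈ P) C) :
    DerivableWithin F (· ∈ insert C P) C := by
  rcases hC with h | h
  · exact .ax C h (Finset.mem_insert_self _ _)
  · exact (hL C h).mono_finset (Finset.subset_insert _ _)

/-- One operation uses at most one new clause, and makes the trail longer by at most one. -/
theorem CDCLStep.sound {F : CNF V} {s s' : CDCLState V} (h : CDCLStep s s')
    {P : Finset (Clause V)} (hs : s.Sound F (DerivableWithin F (· ∈ P))) :
    s'.trail.length ≤ s.trail.length + 1 ∧
    ∃ P' : Finset (Clause V), P'.card ≤ P.card + 1 ∧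
      s'.Sound F (DerivableWithin F (· ∈ P')) := by
  have up : ∀ C : Clause V, ∀ D, DerivableWithin F (· ∈ P) D →
      DerivableWithin F (· ∈ insert C P) D :=
    fun C D hD => hD.mono_finset (Finset.subset_insert _ _)
  obtain ⟨h1, h2, h3, h4⟩ := hs
  cases h with
  | decide F' L t l hl =>
    exact ⟨by simp, P, by simp, h1, h2, h3, fun D hD => by cases hD⟩
  | propagate F' L t l C hC hlC hl hunit =>
    obtain rfl : F' = F := h1
    exact ⟨by simp, insert C P, Finset.card_insert_le _ _, rfl, fun D hD => up C D (h2 D hD),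
      ⟨⟨.insert_input hC h2, hunit⟩, h3.mono (up C)⟩, fun D hD => by cases hD⟩
  | conflict F' L t C hC hfalse =>
    obtain rfl : F' = F := h1
    exact ⟨by simp, insert C P, Finset.card_insert_le _ _, rfl, fun D hD => up C D (h2 D hD),
      h3.mono (up C), fun D hD => by cases hD; exact ⟨.insert_input hC h2, hfalse⟩⟩
  | resolve F' L t D l C he hl =>
    obtain ⟨hC, hC'⟩ := h3.of_mem he
    obtain ⟨hD, hD'⟩ := h4 D rfl
    refine ⟨by simp, insert (D.erase l.neg ∪ C.erase l) P, Finset.card_insert_le _ _, h1,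
      fun E hE => up _ E (h2 E hE), h3.mono (up _), fun E hE => ?_⟩
    cases hE
    refine ⟨.resLit l (up _ _ hC) (up _ _ hD) Finset.subset_union_right
      Finset.subset_union_left (Finset.mem_insert_self _ _), fun l' hl' => ?_⟩
    rcases Finset.mem_union.1 hl' with h | h
    · exact hD' l' (Finset.mem_of_mem_erase h)
    · exact hC' l' (Finset.mem_of_mem_erase h) (Finset.ne_of_mem_erase h)
  | learn F' L t D =>
    refine ⟨by simp, P, by simp, h1, fun E hE => ?_, h3, h4⟩
    rcases Finset.mem_insert.1 hE with rfl | hE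
    · exact (h4 _ rfl).1
    · exact h2 E hE
  | backjump F' L t t' D ht =>
    exact ⟨ht.length_le.trans (Nat.le_succ _), P, by simp, h1, h2, h3.of_suffix ht,
      fun D hD => by cases hD⟩
  | restart F' L t t' ht =>
    exact ⟨ht.length_le.trans (Nat.le_succ _), P, by simp, h1, h2, h3.of_suffix ht,
      fun D hD => by cases hD⟩
  | forget F' L L' t m hL =>
    exact ⟨by simp, P, by simp, h1, fun E hE => h2 E (hL hE), h3, h4⟩

/-- A conflict at decision level zero yields the empty clause. -/
theorem Trail.Justified.derivable_empty {F : CNF V} {t : Trail V} (hlev : t.IsLevelZero) :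
    ∀ (P : Finset (Clause V)) (D : Clause V), t.Justified (DerivableWithin F (· ∈ P)) →
      DerivableWithin F (· ∈ P) D → (∀ l ∈ D, t.IsFalse l) →
      ∃ P' : Finset (Clause V), P'.card ≤ P.card + t.length ∧ DerivableWithin F (· ∈ P') ∅ := by
  induction t with
  | nil =>
    intro P D _ hD hf
    have : D = ∅ := by
      refine Finset.eq_empty_of_forall_notMem fun l hl => ?_
      obtain ⟨e, he, -⟩ := hf l hl
      simp at he
    exact ⟨P, by simp, this ▸ hD⟩
  | cons e t ih =>
    intro P D ht hD hf
    have hlev' : Trail.IsLevelZero t := fun e he => hlev e (List.mem_cons_of_mem _ he)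
    cases e with
    | decision l => exact absurd rfl (hlev _ List.mem_cons_self l)
    | propagated l C =>
      obtain ⟨⟨hC, hC'⟩, ht⟩ := ht
      have up : ∀ E, DerivableWithin F (· ∈ P) E →
          DerivableWithin F (· ∈ insert (D.erase l.neg ∪ C.erase l) P) E :=
        fun E hE => hE.mono_finset (Finset.subset_insert _ _)
      -- The resolvent with the most recent reason is falsified by the shorter trail. If `l.neg` is
      -- not in `D`, the erasure does nothing and the new clause is a weakening of `D`.
      obtain ⟨P', h1, h2⟩ := ih hlev' (insert (D.erase l.neg ∪ C.erase l) P)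
        (D.erase l.neg ∪ C.erase l) (ht.mono up)
        (.resLit l (up _ hC) (up _ hD) Finset.subset_union_right Finset.subset_union_left
          (Finset.mem_insert_self _ _)) (by
          intro l' hl'
          rcases Finset.mem_union.1 hl' with h | h
          · obtain ⟨hne, h⟩ := Finset.mem_erase.1 h
            obtain ⟨e, he, h3⟩ := hf l' h
            rcases List.mem_cons.1 he with rfl | he
            · refine absurd ?_ hne
              simp only [TrailEntry.lit] at h3
              simp [h3, Literal.neg]
            · exact ⟨e, he, h3⟩
          · exact hC' l' (Finset.mem_of_mem_erase h) (Finset.ne_of_mem_erase h))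
      refine ⟨P', h1.trans ?_, h2⟩
      have := Finset.card_insert_le (D.erase l.neg ∪ C.erase l) P
      simp only [List.length_cons]
      omega

/-- A CDCL run of length `T` yields a resolution refutation with at most `2 * T` clauses. -/
theorem CDCLSolver.CanRefuteInTime.exists_derivation {S : CDCLSolver V} {F : CNF V} {T : ℕ}
    (h : S.CanRefuteInTime F T) :
    ∃ P : Finset (Clause V), P.card ≤ 2 * T ∧ DerivableWithin F (· ∈ P) ∅ := by
  obtain ⟨c, h0, hstep, hT⟩ := h
  have inv : ∀ i ≤ T, (S.state (c i)).trail.length ≤ i ∧ ∃ P : Finset (Clause V), P.card ≤ i ∧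
      (S.state (c i)).Sound F (DerivableWithin F (· ∈ P)) := by
    intro i
    induction i with
    | zero =>
      intro _
      rw [S.state_start F _ h0]
      exact ⟨le_rfl, ∅, le_rfl, rfl, by simp [CDCLState.initial], trivial,
        fun D hD => by cases hD⟩
    | succ i ih =>
      intro hi
      obtain ⟨h1, P, h2, h3⟩ := ih (by omega)
      rcases S.state_next _ _ (hstep i (by omega)) with h | h
      · rw [h]
        exact ⟨by omega, P, by omega, h3⟩
      · obtain ⟨h4, P', h5, h6⟩ := h.sound h3
        exact ⟨by omega, P', by omega, h6⟩
  obtain ⟨h1, P, h2, h3⟩ := inv T le_rfl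
  obtain ⟨D, hD, h4⟩ := S.state_unsat _ hT
  obtain ⟨hD1, hD2⟩ := h3.mode D hD
  rcases h4 with rfl | hlev
  · exact ⟨P, by omega, hD1⟩
  -- At most `T` clauses from the run, and at most one more for each of the at most `T` trail
  -- entries.
  · obtain ⟨P', h5, h6⟩ := h3.trail.derivable_empty hlev P D hD1 hD2
    exact ⟨P', by omega, h6⟩

end CDCL

/-! ### The relativized pigeonhole principle -/

/-- The variables. A pigeon `u : Fin (h + 1)` chooses an `x : Fin N`, and the pair `v = (u, x)` then
chooses a hole `j : Fin h`. `p v`: the pair `v` is chosen; `q v j`: it goes to hole `j`;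
`g v v'`: both `v` and `v'` are chosen; `s u` and `y v` serve to write the wide clauses
"`u` makes some choice" and "`v` makes some choice" with three literals per clause. -/
inductive RelVar (h N : ℕ) where
  | p (v : Fin (h + 1) × Fin N)
  | s (u : Fin (h + 1)) (x : Fin (N + 1))
  | g (v v' : Fin (h + 1) × Fin N)
  | q (v : Fin (h + 1) × Fin N) (j : Fin h)
  | y (v : Fin (h + 1) × Fin N) (j : Fin (h + 1))
  deriving DecidableEq

namespace RelVar

variable {h N : ℕ}

/-- The index type of the variables as a disjoint sum. -/
def toSum : RelVar h N →
    (Fin (h + 1) × Fin N) ⊕ (Fin (h + 1) × Fin (N + 1)) ⊕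
      ((Fin (h + 1) × Fin N) × (Fin (h + 1) × Fin N)) ⊕ ((Fin (h + 1) × Fin N) × Fin h) ⊕
        ((Fin (h + 1) × Fin N) × Fin (h + 1))
  | p v => .inl v
  | s u x => .inr (.inl (u, x))
  | g v v' => .inr (.inr (.inl (v, v')))
  | q v j => .inr (.inr (.inr (.inl (v, j))))
  | y v j => .inr (.inr (.inr (.inr (v, j))))

theorem toSum_injective : Function.Injective (toSum (h := h) (N := N)) := by
  intro a b hab
  cases a <;> cases b <;> simp_all [toSum]

/-- The variables `g` account for the quadratic growth in the number of pairs; this is the source of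
the threshold `1 / 2` for `a`. -/
theorem exists_embedding {n : ℕ} (hN : 1 ≤ N) (hn : 7 * ((h + 1) ^ 2 * N ^ 2) ≤ n) :
    Nonempty (RelVar h N ↪ Fin n) := by
  refine (Function.Embedding.nonempty_of_card_le ?_).map
    fun e => (⟨toSum, toSum_injective⟩ : RelVar h N ↪ _).trans e
  simp only [Fintype.card_sum, Fintype.card_prod, Fintype.card_fin]
  refine le_trans ?_ hn
  obtain ⟨k, rfl⟩ : ∃ k, N = k + 1 := ⟨N - 1, by omega⟩
  ring_nf
  nlinarith [Nat.zero_le (h * k), Nat.zero_le (h ^ 2 * k), Nat.zero_le (h * k ^ 2),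
    Nat.zero_le (h ^ 2 * k ^ 2)]

end RelVar

open RelVar in
/-- The formula: every pigeon `u` makes a choice, every chosen pair chooses a hole, and chosen pairs
of different pigeons go to different holes. -/
def relPHP (h N : ℕ) : CNF (RelVar h N) :=
  (Finset.univ : Finset (Fin (h + 1))).image (fun u => {(s u 0, true)}) ∪
  ((Finset.univ : Finset (Fin (h + 1) × Fin N)).image
    (fun v => {(s v.1 v.2.castSucc, false), (p v, true), (s v.1 v.2.succ, true)}) ∪
  ((Finset.univ : Finset (Fin (h + 1))).image (fun u => {(s u (Fin.last N), false)}) ∪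
  ((Finset.univ : Finset (Fin (h + 1) × Fin N)).image (fun v => {(p v, false), (y v 0, true)}) ∪
  ((Finset.univ : Finset ((Fin (h + 1) × Fin N) × Fin h)).image
    (fun a => {(y a.1 a.2.castSucc, false), (q a.1 a.2, true), (y a.1 a.2.succ, true)}) ∪
  ((Finset.univ : Finset (Fin (h + 1) × Fin N)).image
    (fun v => {(p v, false), (y v (Fin.last h), false)}) ∪
  (((Finset.univ : Finset ((Fin (h + 1) × Fin N) × (Fin (h + 1) × Fin N))).filter
      (fun a => a.1.1 ≠ a.2.1)).image
    (fun a => {(p a.1, false), (p a.2, false), (g a.1 a.2, true)}) ∪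
  ((Finset.univ : Finset (((Fin (h + 1) × Fin N) × (Fin (h + 1) × Fin N)) × Fin h)).filter
      (fun a => a.1.1.1 ≠ a.1.2.1)).image
    (fun a => {(g a.1.1 a.1.2, false), (q a.1.1 a.2, false), (q a.1.2 a.2, false)})))))))

namespace relPHP

open RelVar

variable {h N : ℕ}

theorem s_zero_mem (u : Fin (h + 1)) : {(s u 0, true)} ∈ relPHP h N :=
  Finset.mem_union_left _ (Finset.mem_image_of_mem _ (Finset.mem_univ u))

theorem s_step_mem (u : Fin (h + 1)) (x : Fin N) :
    {(s u x.castSucc, false), (p (u, x), true), (s u x.succ, true)} ∈ relPHP h N :=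
  Finset.mem_union_right _ (Finset.mem_union_left _
    (Finset.mem_image.2 ⟨(u, x), Finset.mem_univ _, rfl⟩))

theorem s_last_mem (u : Fin (h + 1)) : {(s u (Fin.last N), false)} ∈ relPHP h N :=
  Finset.mem_union_right _ (Finset.mem_union_right _ (Finset.mem_union_left _
    (Finset.mem_image.2 ⟨u, Finset.mem_univ _, rfl⟩)))

theorem y_zero_mem (v : Fin (h + 1) × Fin N) : {(p v, false), (y v 0, true)} ∈ relPHP h N :=
  Finset.mem_union_right _ (Finset.mem_union_right _ (Finset.mem_union_right _
    (Finset.mem_union_left _ (Finset.mem_image.2 ⟨v, Finset.mem_univ _, rfl⟩))))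

theorem y_step_mem (v : Fin (h + 1) × Fin N) (j : Fin h) :
    {(y v j.castSucc, false), (q v j, true), (y v j.succ, true)} ∈ relPHP h N :=
  Finset.mem_union_right _ (Finset.mem_union_right _ (Finset.mem_union_right _
    (Finset.mem_union_right _ (Finset.mem_union_left _
      (Finset.mem_image.2 ⟨(v, j), Finset.mem_univ _, rfl⟩)))))

theorem y_last_mem (v : Fin (h + 1) × Fin N) :
    {(p v, false), (y v (Fin.last h), false)} ∈ relPHP h N :=
  Finset.mem_union_right _ (Finset.mem_union_right _ (Finset.mem_union_right _
    (Finset.mem_union_right _ (Finset.mem_union_right _ (Finset.mem_union_left _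
      (Finset.mem_image.2 ⟨v, Finset.mem_univ _, rfl⟩))))))

theorem g_mem {v v' : Fin (h + 1) × Fin N} (hv : v.1 ≠ v'.1) :
    {(p v, false), (p v', false), (g v v', true)} ∈ relPHP h N :=
  Finset.mem_union_right _ (Finset.mem_union_right _ (Finset.mem_union_right _
    (Finset.mem_union_right _ (Finset.mem_union_right _ (Finset.mem_union_right _
      (Finset.mem_union_left _
        (Finset.mem_image.2 ⟨(v, v'), Finset.mem_filter.2 ⟨Finset.mem_univ _, hv⟩, rfl⟩)))))))

theorem hole_mem {v v' : Fin (h + 1) × Fin N} (hv : v.1 ≠ v'.1) (j : Fin h) :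
    {(g v v', false), (q v j, false), (q v' j, false)} ∈ relPHP h N :=
  Finset.mem_union_right _ (Finset.mem_union_right _ (Finset.mem_union_right _
    (Finset.mem_union_right _ (Finset.mem_union_right _ (Finset.mem_union_right _
      (Finset.mem_union_right _
        (Finset.mem_image.2 ⟨((v, v'), j), Finset.mem_filter.2 ⟨Finset.mem_univ _, hv⟩, rfl⟩)))))))

/-- To show something for every clause of the formula, consider the eight kinds of clauses. -/
theorem forall_mem {Q : Clause (RelVar h N) → Prop}
    (h1 : ∀ u, Q {(s u 0, true)})
    (h2 : ∀ u x, Q {(s u x.castSucc, false), (p (u, x), true), (s u x.succ, true)})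
    (h3 : ∀ u, Q {(s u (Fin.last N), false)})
    (h4 : ∀ v, Q {(p v, false), (y v 0, true)})
    (h5 : ∀ v j, Q {(y v j.castSucc, false), (q v j, true), (y v j.succ, true)})
    (h6 : ∀ v, Q {(p v, false), (y v (Fin.last h), false)})
    (h7 : ∀ v v', v.1 ≠ v'.1 → Q {(p v, false), (p v', false), (g v v', true)})
    (h8 : ∀ v v' j, v.1 ≠ v'.1 → Q {(g v v', false), (q v j, false), (q v' j, false)}) :
    ∀ C ∈ relPHP h N, Q C := by
  intro C hC
  simp only [relPHP, Finset.mem_union, Finset.mem_image, Finset.mem_filter, Finset.mem_univ,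
    true_and] at hC
  rcases hC with ⟨u, rfl⟩ | ⟨v, rfl⟩ | ⟨u, rfl⟩ | ⟨v, rfl⟩ | ⟨a, rfl⟩ | ⟨v, rfl⟩ | ⟨a, ha, rfl⟩ |
    ⟨a, ha, rfl⟩
  · exact h1 u
  · exact h2 v.1 v.2
  · exact h3 u
  · exact h4 v
  · exact h5 a.1 a.2
  · exact h6 v
  · exact h7 _ _ ha
  · exact h8 _ _ _ ha

theorem isKCNF : (relPHP h N).IsKCNF 3 := by
  refine forall_mem ?_ ?_ ?_ ?_ ?_ ?_ ?_ ?_ <;> intros <;>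
    first
    | exact Finset.card_le_three
    | exact Finset.card_le_two.trans (by norm_num)
    | simp

/-- The hole clauses have one more index, the hole, than the variables `g`. This extra factor
becomes the `w` in `K * w * n`. -/
theorem card_le (hN : 1 ≤ N) : (relPHP h N).card ≤ 8 * ((h + 1) * ((h + 1) ^ 2 * N ^ 2)) := by
  have union : ∀ {A B : CNF (RelVar h N)} {a b : ℕ}, A.card ≤ a → B.card ≤ b →
      (A ∪ B).card ≤ a + b :=
    fun hA hB => (Finset.card_union_le _ _).trans (Nat.add_le_add hA hB)
  have image : ∀ {ι : Type} [Fintype ι] (f : ι → Clause (RelVar h N)),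
      (Finset.univ.image f).card ≤ Fintype.card ι := fun f => Finset.card_image_le
  have filter : ∀ {ι : Type} [Fintype ι] (P : ι → Prop) [DecidablePred P]
      (f : ι → Clause (RelVar h N)), ((Finset.univ.filter P).image f).card ≤ Fintype.card ι :=
    fun P _ f => Finset.card_image_le.trans (Finset.card_filter_le _ _)
  refine (union (image _) (union (image _) (union (image _) (union (image _) (union (image _)
    (union (image _) (union (filter _ _) (filter _ _)))))))).trans ?_
  simp only [Fintype.card_prod, Fintype.card_fin]
  obtain ⟨k, rfl⟩ : ∃ k, N = k + 1 := ⟨N - 1, by omega⟩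
  have h0 : (h + 1) * (k + 1) ≤ (h + 1) * ((h + 1) ^ 2 * (k + 1) ^ 2) := by
    rw [← mul_pow]
    refine Nat.mul_le_mul_left _ ?_
    calc k + 1 ≤ (h + 1) * (k + 1) := Nat.le_mul_of_pos_left _ (Nat.succ_pos _)
      _ ≤ ((h + 1) * (k + 1)) ^ 2 := Nat.le_self_pow two_ne_zero _
  have h1 : h + 1 ≤ (h + 1) * (k + 1) := Nat.le_mul_of_pos_right _ (Nat.succ_pos _)
  have h2 : (h + 1) * (k + 1) * h + (h + 1) * (k + 1) ≤ (h + 1) * ((h + 1) ^ 2 * (k + 1) ^ 2) := by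
    calc (h + 1) * (k + 1) * h + (h + 1) * (k + 1) = (h + 1) * ((h + 1) * (k + 1)) := by ring
      _ ≤ (h + 1) * ((h + 1) ^ 2 * (k + 1) ^ 2) := by
        rw [← mul_pow]
        exact Nat.mul_le_mul_left _ (Nat.le_self_pow two_ne_zero _)
  have h3 : (h + 1) * (k + 1) * ((h + 1) * (k + 1)) +
      (h + 1) * (k + 1) * ((h + 1) * (k + 1)) * h = (h + 1) * ((h + 1) ^ 2 * (k + 1) ^ 2) := by
    ring
  omega

end relPHP

/-! ### A narrow refutation -/

/-- If `a 0` and `¬ a m` hold and `a j` implies `b j ∨ a (j + 1)`, then some `b j` holds. -/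
theorem DerivableWithin.chain {V : Type} [DecidableEq V] {F : CNF V} {w m : ℕ}
    (a : Fin (m + 1) → V) (b : Fin m → V) (D : Clause V) (hw : 3 ≤ w) (hD : D.card + 2 ≤ w)
    (h0 : DerivableWithin F (fun C => C.card ≤ w) (insert (a 0, true) D))
    (hlast : DerivableWithin F (fun C => C.card ≤ w) (insert (a (Fin.last m), false) D))
    (hstep : ∀ j : Fin m, {(a j.castSucc, false), (b j, true), (a j.succ, true)} ∈ F)
    (hb : ∀ j, DerivableWithin F (fun C => C.card ≤ w) (insert (b j, false) D)) :
    DerivableWithin F (fun C => C.card ≤ w) D := by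
  have c1 : ∀ l : Literal V, (insert l D).card ≤ w :=
    fun l => (Finset.card_insert_le _ _).trans (by omega)
  have c2 : ∀ l l' : Literal V, (insert l (insert l' D)).card ≤ w := fun l l' =>
    (Finset.card_insert_le _ _).trans
      ((Nat.add_le_add_right (Finset.card_insert_le _ _) 1).trans (by omega))
  have key : ∀ j, DerivableWithin F (fun C => C.card ≤ w) (insert (a j, true) D) := by
    intro j
    induction j using Fin.induction with
    | zero => exact h0
    | succ j ih =>
      -- The intermediate clause has two literals besides `D`, which is what `hD` allows for.
      refine .res (b j) (insert (b j, true) (insert (a j.succ, true) D)) _ _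
        (.res (a j.castSucc) _ _ _ ih (.ax _ (hstep j) (Finset.card_le_three.trans hw)) ?_ ?_
          (c2 _ _)) (hb j) (Finset.erase_insert_subset _ _)
        ((Finset.erase_insert_subset _ _).trans (Finset.subset_insert _ _)) (c1 _)
      · exact (Finset.erase_insert_subset _ _).trans
          ((Finset.subset_insert _ _).trans (Finset.subset_insert _ _))
      · refine (Finset.erase_insert_subset _ _).trans (Finset.insert_subset_insert _ ?_)
        simp
  exact .res (a (Fin.last m)) _ _ _ (key _) hlast (Finset.erase_insert_subset _ _)
    (Finset.erase_insert_subset _ _) (by omega)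

namespace relPHP

open RelVar

variable {h N : ℕ}

/-- The clause stating that not every pigeon `u < i` chooses `x u` and the hole `f u`. -/
def stateClause (i : ℕ) (x : Fin (h + 1) → Fin N) (f : Fin (h + 1) → Fin h) :
    Clause (RelVar h N) :=
  (Finset.univ.filter (fun u : Fin (h + 1) => u.val < i)).image (fun u => (p (u, x u), false)) ∪
  (Finset.univ.filter (fun u : Fin (h + 1) => u.val < i)).image
    (fun u => (q (u, x u) (f u), false))

theorem p_mem_stateClause {i : ℕ} {x : Fin (h + 1) → Fin N} {f : Fin (h + 1) → Fin h}
    {u : Fin (h + 1)} (hu : u.val < i) : (p (u, x u), false) ∈ stateClause i x f :=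
  Finset.mem_union_left _ (Finset.mem_image.2 ⟨u, by simpa using hu, rfl⟩)

theorem q_mem_stateClause {i : ℕ} {x : Fin (h + 1) → Fin N} {f : Fin (h + 1) → Fin h}
    {u : Fin (h + 1)} (hu : u.val < i) : (q (u, x u) (f u), false) ∈ stateClause i x f :=
  Finset.mem_union_right _ (Finset.mem_image.2 ⟨u, by simpa using hu, rfl⟩)

theorem card_stateClause_le (i : ℕ) (x : Fin (h + 1) → Fin N) (f : Fin (h + 1) → Fin h) :
    (stateClause i x f).card ≤ 2 * (h + 1) := by
  have hc : (Finset.univ.filter (fun u : Fin (h + 1) => u.val < i)).card ≤ h + 1 := by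
    simpa using Finset.card_filter_le (Finset.univ : Finset (Fin (h + 1))) _
  refine (Finset.card_union_le _ _).trans ?_
  have h1 := Finset.card_image_le (s := Finset.univ.filter (fun u : Fin (h + 1) => u.val < i))
    (f := fun u => ((p (u, x u), false) : Literal (RelVar h N)))
  have h2 := Finset.card_image_le (s := Finset.univ.filter (fun u : Fin (h + 1) => u.val < i))
    (f := fun u => ((q (u, x u) (f u), false) : Literal (RelVar h N)))
  omega

/-- Two pigeons share a hole under `f`; resolving their two axioms on the variable `g` gives a
subclause. -/
theorem derivable_stateClause_last (x : Fin (h + 1) → Fin N) (f : Fin (h + 1) → Fin h) :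
    DerivableWithin (relPHP h N) (fun C => C.card ≤ 2 * h + 5) (stateClause (h + 1) x f) := by
  obtain ⟨u, u', hne, hf⟩ := Fintype.exists_ne_map_eq_of_card_lt f (by simp)
  have hv : ((u, x u) : Fin (h + 1) × Fin N).1 ≠ (u', x u').1 := hne
  refine .res (g (u, x u) (u', x u')) _ _ _
    (.ax _ (g_mem hv) (Finset.card_le_three.trans (by omega)))
    (.ax _ (hole_mem hv (f u)) (Finset.card_le_three.trans (by omega))) ?_ ?_
    ((card_stateClause_le _ _ _).trans (by omega))
  · intro l hl
    simp only [Finset.mem_erase, Finset.mem_insert, Finset.mem_singleton] at hl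
    obtain ⟨h1, rfl | rfl | rfl⟩ := hl
    · exact p_mem_stateClause u.2
    · exact p_mem_stateClause u'.2
    · exact absurd rfl h1
  · intro l hl
    simp only [Finset.mem_erase, Finset.mem_insert, Finset.mem_singleton] at hl
    obtain ⟨h1, rfl | rfl | rfl⟩ := hl
    · exact absurd rfl h1
    · exact q_mem_stateClause u.2
    · rw [hf]; exact q_mem_stateClause u'.2

/-- Backward induction, `k` being the number of pigeons not yet placed. Two nested chains run over
the copies `x'` and the holes `j` of pigeon `i`. The inner one has `p (u, x')` as an additional
literal, so the width is at most `(2 * h + 2) + 1 + 2`. -/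
theorem derivable_stateClause (k : ℕ) : ∀ i, i + k = h + 1 →
    ∀ (x : Fin (h + 1) → Fin N) (f : Fin (h + 1) → Fin h),
      DerivableWithin (relPHP h N) (fun C => C.card ≤ 2 * h + 5) (stateClause i x f) := by
  induction k with
  | zero =>
    rintro i rfl x f
    exact derivable_stateClause_last x f
  | succ k ih =>
    intro i hi x f
    have hcard := card_stateClause_le i x f
    let u : Fin (h + 1) := ⟨i, by omega⟩
    have c1 : ∀ l, (insert l (stateClause i x f)).card ≤ 2 * h + 3 :=
      fun l => (Finset.card_insert_le _ _).trans (by omega)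
    have c2 : ∀ l l', (insert l (insert l' (stateClause i x f))).card ≤ 2 * h + 5 :=
      fun l l' => (Finset.card_insert_le _ _).trans (by have := c1 l'; omega)
    refine .chain (s u) (fun x' => p (u, x')) _ (by omega) (by omega) ?_ ?_ (s_step_mem u) ?_
    · exact .weaken _ _ (.ax _ (s_zero_mem u) (by simp)) (by simp) ((c1 _).trans (by omega))
    · exact .weaken _ _ (.ax _ (s_last_mem u) (by simp)) (by simp) ((c1 _).trans (by omega))
    intro x'
    refine .chain (y (u, x')) (q (u, x')) _ (by omega) (by have := c1 (p (u, x'), false); omega)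
      ?_ ?_ (y_step_mem (u, x')) ?_
    · refine .weaken _ _ (.ax _ (y_zero_mem (u, x')) (Finset.card_le_two.trans (by omega))) ?_
        (c2 _ _)
      intro l hl
      simp only [Finset.mem_insert, Finset.mem_singleton] at hl ⊢
      tauto
    · refine .weaken _ _ (.ax _ (y_last_mem (u, x')) (Finset.card_le_two.trans (by omega))) ?_
        (c2 _ _)
      intro l hl
      simp only [Finset.mem_insert, Finset.mem_singleton] at hl ⊢
      tauto
    intro j
    refine .weaken _ _ (ih (i + 1) (by omega) (Function.update x u x') (Function.update f u j)) ?_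
      (c2 _ _)
    have split : ∀ u' : Fin (h + 1), u'.val < i + 1 → u' = u ∨ (u'.val < i ∧ u' ≠ u) := by
      intro u' hu'
      by_cases h1 : u' = u
      · exact Or.inl h1
      · refine Or.inr ⟨?_, h1⟩
        have : u'.val ≠ i := fun h2 => h1 (Fin.ext h2)
        omega
    intro l hl
    simp only [stateClause, Finset.mem_union, Finset.mem_image, Finset.mem_filter, Finset.mem_univ,
      true_and] at hl
    rcases hl with ⟨u', hu', rfl⟩ | ⟨u', hu', rfl⟩
    · rcases split u' hu' with rfl | ⟨h1, h2⟩
      · simp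
      · rw [Function.update_of_ne h2]
        exact Finset.mem_insert_of_mem (Finset.mem_insert_of_mem (p_mem_stateClause h1))
    · rcases split u' hu' with rfl | ⟨h1, h2⟩
      · simp
      · rw [Function.update_of_ne h2, Function.update_of_ne h2]
        exact Finset.mem_insert_of_mem (Finset.mem_insert_of_mem (q_mem_stateClause h1))

theorem derivable_empty (hh : 1 ≤ h) (hN : 1 ≤ N) :
    DerivableWithin (relPHP h N) (fun C => C.card ≤ 2 * h + 5) ∅ := by
  have := derivable_stateClause (h := h) (N := N) (h + 1) 0 (by omega) (fun _ => ⟨0, hN⟩)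
    (fun _ => ⟨0, hh⟩)
  simpa [stateClause] using this

end relPHP

/-! ### The lower bound -/

/-- Few functions agree with `β` on all of `M` but one selected point of `M`. -/
theorem card_selected_agreeing_le {N : ℕ} (M : Finset (Fin N)) (β : Fin N → Bool) :
    ((Finset.univ : Finset (Fin N × (Fin N → Bool))).filter
      (fun a => a.1 ∈ M ∧ ∀ x ∈ M, x ≠ a.1 → a.2 x = β x)).card ≤ 2 ^ N := by
  let B : Fin N → Finset (Fin N → Bool) := fun x =>
    Fintype.piFinset fun x' => if x' ∈ M.erase x then {β x'} else Finset.univ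
  have hB : ∀ x ∈ M, (B x).card = 2 ^ (N - (M.card - 1)) := by
    intro x hx
    have hval : ∀ x' : Fin N, (if x' ∈ M.erase x then ({β x'} : Finset Bool) else Finset.univ).card =
        if x' ∈ M.erase x then 1 else 2 := by
      intro x'
      split_ifs <;> simp
    rw [Fintype.card_piFinset, Finset.prod_congr rfl fun x' _ => hval x', Finset.prod_ite,
      Finset.prod_const_one, one_mul, Finset.prod_const]
    congr 1
    rw [Finset.filter_not, Finset.filter_mem_eq_inter, Finset.univ_inter,
      Finset.card_sdiff_of_subset (Finset.subset_univ _), Finset.card_erase_of_mem hx,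
      Finset.card_univ, Fintype.card_fin]
  have hsub : (Finset.univ : Finset (Fin N × (Fin N → Bool))).filter
      (fun a => a.1 ∈ M ∧ ∀ x ∈ M, x ≠ a.1 → a.2 x = β x) ⊆ M.biUnion fun x => {x} ×ˢ B x := by
    rintro ⟨x, c⟩ hxc
    obtain ⟨-, hx, hc⟩ := Finset.mem_filter.1 hxc
    refine Finset.mem_biUnion.2 ⟨x, hx, Finset.mem_product.2 ⟨Finset.mem_singleton_self _, ?_⟩⟩
    refine Fintype.mem_piFinset.2 fun x' => ?_
    split_ifs with h
    · exact Finset.mem_singleton.2 (hc x' (Finset.mem_of_mem_erase h) (Finset.ne_of_mem_erase h))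
    · exact Finset.mem_univ _
  refine (Finset.card_le_card hsub).trans (Finset.card_biUnion_le.trans ?_)
  have hcard : ∀ x ∈ M, ({x} ×ˢ B x).card = 2 ^ (N - (M.card - 1)) := by
    intro x hx
    rw [Finset.card_product, Finset.card_singleton, one_mul, hB x hx]
  rw [Finset.sum_congr rfl hcard, Finset.sum_const, smul_eq_mul]
  have hM : M.card ≤ N := by simpa using Finset.card_le_univ M
  rcases Nat.eq_zero_or_pos M.card with h0 | h0
  · simp [h0]
  -- The choice of the selected point in `M` is paid for by the bits forced at the other points: `m
  -- ≤ 2 ^ (m - 1)`.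
  · calc M.card * 2 ^ (N - (M.card - 1)) ≤ 2 ^ (M.card - 1) * 2 ^ (N - (M.card - 1)) := by
          refine Nat.mul_le_mul_right _ ?_
          have := Nat.lt_two_pow_self (n := M.card - 1)
          omega
      _ = 2 ^ N := by rw [← pow_add]; congr 1; omega

namespace relPHP

open RelVar

variable {h N : ℕ}

/-- For every pigeon `u` a selected `x`, and for every `(u, x')` the common value of the variables
`q (u, x') j` and `y (u, x') j` if `x'` is not selected. -/
abbrev Restriction (h N : ℕ) := Fin (h + 1) → Fin N × (Fin N → Bool)

/-- The assignment in which a selected pair `(u, x)` goes to the hole `f u`. -/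
def val (ω : Restriction h N) (f : Fin (h + 1) → Fin h) : RelVar h N → Bool
  | p v => decide (v.2 = (ω v.1).1)
  | s u x => decide (x.val ≤ (ω u).1.val)
  | g v v' => decide (v.2 = (ω v.1).1 ∧ v'.2 = (ω v'.1).1)
  | q v j => if v.2 = (ω v.1).1 then decide (f v.1 = j) else (ω v.1).2 v.2
  | y v j => if v.2 = (ω v.1).1 then decide (j.val ≤ (f v.1).val) else (ω v.1).2 v.2

/-- The pair about whose hole the variable speaks. -/
def pair : RelVar h N → Option (Fin (h + 1) × Fin N)
  | q v _ => some v
  | y v _ => some v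
  | _ => none

/-- The pigeons about whose hole the clause speaks. -/
def mentioned (ω : Restriction h N) (C : Clause (RelVar h N)) : Finset (Fin (h + 1)) :=
  Finset.univ.filter fun u => ∃ l ∈ C, pair l.1 = some (u, (ω u).1)

theorem mem_mentioned {ω : Restriction h N} {C : Clause (RelVar h N)} {u : Fin (h + 1)} :
    u ∈ mentioned ω C ↔ ∃ l ∈ C, pair l.1 = some (u, (ω u).1) := by
  simp [mentioned]

/-- The restriction does not satisfy `C`, which mentions all pigeons but at most one. -/
def IsWide (ω : Restriction h N) (C : Clause (RelVar h N)) : Prop :=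
  (∀ l ∈ C, ∀ v, pair l.1 = some v → v.2 ≠ (ω v.1).1 → (ω v.1).2 v.2 ≠ l.2) ∧
    h ≤ (mentioned ω C).card

/-- Holes of pigeons that a clause does not mention are irrelevant to it, so a total `f` that is
injective on the mentioned pigeons can play the role of a partial matching. -/
theorem val_congr {ω : Restriction h N} {f f' : Fin (h + 1) → Fin h} {z : RelVar h N}
    (hz : ∀ u, pair z = some (u, (ω u).1) → f u = f' u) : val ω f z = val ω f' z := by
  cases z with
  | p v => rfl
  | s u x => rfl
  | g v v' => rfl
  | q v j =>
    by_cases hv : v.2 = (ω v.1).1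
    · have := hz v.1 (by simp [pair, ← hv])
      simp [val, this]
    · simp [val, hv]
  | y v j =>
    by_cases hv : v.2 = (ω v.1).1
    · have := hz v.1 (by simp [pair, ← hv])
      simp [val, this]
    · simp [val, hv]

theorem val_of_not_selected {ω : Restriction h N} (f : Fin (h + 1) → Fin h) {z : RelVar h N}
    {v : Fin (h + 1) × Fin N} (hz : pair z = some v) (hv : v.2 ≠ (ω v.1).1) :
    val ω f z = (ω v.1).2 v.2 := by
  cases z <;> simp only [pair, Option.some.injEq, reduceCtorEq] at hz <;> subst hz <;>
    simp [val, hv]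

/-- A clause of the formula is true if the pigeons it mentions are in different holes. -/
theorem input_clause_true (ω : Restriction h N) (f : Fin (h + 1) → Fin h) :
    ∀ C ∈ relPHP h N, Set.InjOn f (mentioned ω C) → ∃ l ∈ C, val ω f l.1 = l.2 := by
  refine forall_mem ?_ ?_ ?_ ?_ ?_ ?_ ?_ ?_
  · intro u _
    simp [val]
  · intro u x _
    by_cases h1 : x.val ≤ (ω u).1.val
    · by_cases h2 : x = (ω u).1
      · exact ⟨(p (u, x), true), by simp, by simp [val, h2]⟩
      · have h3 : x.val ≠ (ω u).1.val := fun h => h2 (Fin.ext h)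
        refine ⟨(s u x.succ, true), by simp, ?_⟩
        simp only [val, Fin.val_succ, decide_eq_true_eq]
        omega
    · refine ⟨(s u x.castSucc, false), by simp, ?_⟩
      simp only [val, Fin.val_castSucc, decide_eq_false_iff_not]
      exact h1
  · intro u _
    simp [val]
  · intro v _
    by_cases hv : v.2 = (ω v.1).1
    · exact ⟨(y v 0, true), by simp, by simp [val, hv]⟩
    · exact ⟨(p v, false), by simp, by simp [val, hv]⟩
  · intro v j _
    by_cases hv : v.2 = (ω v.1).1
    · by_cases h1 : j.val ≤ (f v.1).val
      · by_cases h2 : f v.1 = j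
        · exact ⟨(q v j, true), by simp, by simp [val, hv, h2]⟩
        · have h3 : (f v.1).val ≠ j.val := fun h => h2 (Fin.ext h)
          refine ⟨(y v j.succ, true), by simp, ?_⟩
          simp only [val, hv, if_true, Fin.val_succ, decide_eq_true_eq]
          omega
      · refine ⟨(y v j.castSucc, false), by simp, ?_⟩
        simp only [val, hv, if_true, Fin.val_castSucc, decide_eq_false_iff_not]
        exact h1
    -- Off the selection `y` and `q` share one bit and occur here with both signs, so either value
    -- satisfies the clause.
    · cases hb : (ω v.1).2 v.2
      · exact ⟨(y v j.castSucc, false), by simp, by simp [val, hv, hb]⟩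
      · exact ⟨(q v j, true), by simp, by simp [val, hv, hb]⟩
  · intro v _
    by_cases hv : v.2 = (ω v.1).1
    · exact ⟨(y v (Fin.last h), false), by simp, by simp [val, hv]⟩
    · exact ⟨(p v, false), by simp, by simp [val, hv]⟩
  · intro v v' _ _
    by_cases hv : v.2 = (ω v.1).1
    · by_cases hv' : v'.2 = (ω v'.1).1
      · exact ⟨(g v v', true), by simp, by simp [val, hv, hv']⟩
      · exact ⟨(p v', false), by simp, by simp [val, hv']⟩
    · exact ⟨(p v, false), by simp, by simp [val, hv]⟩
  · intro v v' j hne hf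
    by_cases hv : v.2 = (ω v.1).1 ∧ v'.2 = (ω v'.1).1
    · have h1 : f v.1 ≠ f v'.1 := fun h => hne (hf
        (mem_mentioned.2 ⟨(q v j, false), by simp, by simp [pair, ← hv.1]⟩)
        (mem_mentioned.2 ⟨(q v' j, false), by simp, by simp [pair, ← hv.2]⟩) h)
      by_cases h2 : f v.1 = j
      · exact ⟨(q v' j, false), by simp, by simp [val, hv.2, ← h2, h1.symm]⟩
      · exact ⟨(q v j, false), by simp, by simp [val, hv.1, h2]⟩
    · exact ⟨(g v v', false), by simp, by simp [val, hv]⟩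

/-- As long as no clause is wide, all clauses are true under all matchings. -/
theorem clause_true {ω : Restriction h N} {P : Clause (RelVar h N) → Prop}
    (hP : ∀ C, P C → ¬ IsWide ω C) {C : Clause (RelVar h N)}
    (hC : DerivableWithin (relPHP h N) P C) :
    ∀ f : Fin (h + 1) → Fin h, Set.InjOn f (mentioned ω C) → ∃ l ∈ C, val ω f l.1 = l.2 := by
  induction hC with
  | ax C hC _ => exact fun f hf => input_clause_true ω f C hC hf
  | weaken A C _ hAC _ ih =>
    intro f hf
    obtain ⟨l, hl, h1⟩ := ih f (hf.mono fun u hu => by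
      obtain ⟨l, hl, h1⟩ := mem_mentioned.1 hu
      exact mem_mentioned.2 ⟨l, hAC hl, h1⟩)
    exact ⟨l, hAC hl, h1⟩
  | res z A B C _ _ hAC hBC hPC ihA ihB =>
    intro f hf
    by_cases hsat : ∀ l ∈ C, ∀ v, pair l.1 = some v → v.2 ≠ (ω v.1).1 → (ω v.1).2 v.2 ≠ l.2
    swap
    · push Not at hsat
      obtain ⟨l, hl, v, h1, h2, h3⟩ := hsat
      exact ⟨l, hl, by rw [val_of_not_selected f h1 h2, h3]⟩
    have hlt : (mentioned ω C).card < h := by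
      by_contra hcon
      exact hP C hPC ⟨hsat, not_lt.1 hcon⟩
    have hsub : ∀ (b : Bool) (A : Clause (RelVar h N)), A.erase (z, b) ⊆ C →
        ∀ u ∈ mentioned ω A, u ∈ mentioned ω C ∨ pair z = some (u, (ω u).1) := by
      intro b A hAC u hu
      obtain ⟨l, hl, h1⟩ := mem_mentioned.1 hu
      by_cases hlz : l = (z, b)
      · right; rw [← h1, hlz]
      · exact Or.inl (mem_mentioned.2 ⟨l, hAC (Finset.mem_erase.2 ⟨hlz, hl⟩), h1⟩)
    -- The premises mention at most one further pigeon, that of the pivot. Fewer than `h` holes are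
    -- occupied, so it can be given a free one.
    obtain ⟨f', hinj, hagree⟩ : ∃ f' : Fin (h + 1) → Fin h,
        Set.InjOn f' {u | u ∈ mentioned ω C ∨ pair z = some (u, (ω u).1)} ∧
        ∀ u ∈ mentioned ω C, f' u = f u := by
      by_cases hz : ∃ u, u ∉ mentioned ω C ∧ pair z = some (u, (ω u).1)
      · obtain ⟨u, hu, hzu⟩ := hz
        obtain ⟨j, hj⟩ : ∃ j, j ∉ (mentioned ω C).image f := by
          by_contra hcon
          push Not at hcon
          have h1 := Finset.card_le_card (fun j _ => hcon j : Finset.univ ⊆ (mentioned ω C).image f)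
          have h2 := Finset.card_image_le (s := mentioned ω C) (f := f)
          simp only [Finset.card_univ, Fintype.card_fin] at h1
          omega
        have hset : {u | u ∈ mentioned ω C ∨ pair z = some (u, (ω u).1)} =
            insert u (mentioned ω C : Set (Fin (h + 1))) := by
          ext u'
          simp only [Set.mem_ofPred_eq, Set.mem_insert_iff, Finset.mem_coe, hzu, Option.some.injEq,
            Prod.mk.injEq]
          constructor
          · rintro (h1 | h1)
            · exact Or.inr h1
            · exact Or.inl h1.1.symm
          · rintro (rfl | h1)
            · exact Or.inr ⟨rfl, rfl⟩
            · exact Or.inl h1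
        have hag : ∀ u' ∈ mentioned ω C, Function.update f u j u' = f u' :=
          fun u' hu' => Function.update_of_ne (by rintro rfl; exact hu hu') _ _
        refine ⟨Function.update f u j, ?_, hag⟩
        rw [hset, Set.injOn_insert (by simpa using hu)]
        refine ⟨hf.congr fun u' hu' => (hag u' hu').symm, ?_⟩
        rintro ⟨u', hu', h1⟩
        rw [hag u' hu', Function.update_self] at h1
        exact hj (Finset.mem_image.2 ⟨u', hu', h1⟩)
      · push Not at hz
        refine ⟨f, hf.mono fun u hu => ?_, fun _ _ => rfl⟩
        rcases hu with h1 | h1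
        · exact h1
        · by_contra h2
          exact hz u h2 h1
    have hCtrue : ∀ l ∈ C, val ω f' l.1 = l.2 → ∃ l ∈ C, val ω f l.1 = l.2 := fun l hl h1 =>
      ⟨l, hl, by rw [← h1]; exact val_congr fun u hu => (hagree u (mem_mentioned.2 ⟨l, hl, hu⟩)).symm⟩
    cases hx : val ω f' z
    · obtain ⟨l, hl, h1⟩ := ihA f' (hinj.mono (hsub _ A hAC))
      refine hCtrue l (hAC (Finset.mem_erase.2 ⟨?_, hl⟩)) h1
      rintro rfl
      simp [hx] at h1
    · obtain ⟨l, hl, h1⟩ := ihB f' (hinj.mono (hsub _ B hBC))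
      refine hCtrue l (hBC (Finset.mem_erase.2 ⟨?_, hl⟩)) h1
      rintro rfl
      simp [hx] at h1

/-- Every refutation contains a wide clause. -/
theorem exists_isWide (hh : 1 ≤ h) (ω : Restriction h N) {P : Finset (Clause (RelVar h N))}
    (hP : DerivableWithin (relPHP h N) (· ∈ P) ∅) : ∃ C ∈ P, IsWide ω C := by
  by_contra hcon
  push Not at hcon
  obtain ⟨l, hl, -⟩ := clause_true hcon hP (fun _ => ⟨0, hh⟩) (by simp [mentioned])
  simp at hl

/-- A clause is wide for few restrictions. -/
theorem card_isWide_le (C : Clause (RelVar h N)) [DecidablePred fun ω => IsWide ω C] :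
    ((Finset.univ : Finset (Restriction h N)).filter (fun ω => IsWide ω C)).card ≤
      (h + 1) * (N * 2 ^ N * (2 ^ N) ^ h) := by
  let M : Fin (h + 1) → Finset (Fin N) := fun u =>
    Finset.univ.filter fun x => ∃ l ∈ C, pair l.1 = some (u, x)
  -- The only bit that can leave all literals of `C` about the copy `x` of `u` false.
  let β : Fin (h + 1) → Fin N → Bool := fun u x =>
    decide (∃ l ∈ C, pair l.1 = some (u, x) ∧ l.2 = false)
  let S : Fin (h + 1) → Finset (Fin N × (Fin N → Bool)) := fun u =>
    Finset.univ.filter fun a => a.1 ∈ M u ∧ ∀ x ∈ M u, x ≠ a.1 → a.2 x = β u x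
  have hsub : (Finset.univ : Finset (Restriction h N)).filter (fun ω => IsWide ω C) ⊆
      Finset.univ.biUnion fun u₀ : Fin (h + 1) =>
        Fintype.piFinset fun u => if u = u₀ then Finset.univ else S u := by
    intro ω hω
    obtain ⟨-, hω1, hω2⟩ := Finset.mem_filter.1 hω
    have hcompl : (mentioned ω C)ᶜ.card ≤ 1 := by
      rw [Finset.card_compl, Fintype.card_fin]
      omega
    obtain ⟨u₀, hu₀⟩ := Finset.card_le_one_iff_subset_singleton.1 hcompl
    refine Finset.mem_biUnion.2 ⟨u₀, Finset.mem_univ _, Fintype.mem_piFinset.2 fun u => ?_⟩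
    split_ifs with hu
    · exact Finset.mem_univ _
    have hmem : u ∈ mentioned ω C := by
      by_contra hcon
      exact hu (Finset.mem_singleton.1 (hu₀ (Finset.mem_compl.2 hcon)))
    refine Finset.mem_filter.2 ⟨Finset.mem_univ _,
      Finset.mem_filter.2 ⟨Finset.mem_univ _, mem_mentioned.1 hmem⟩, fun x hx hne => ?_⟩
    obtain ⟨-, l, hl, h1⟩ := Finset.mem_filter.1 hx
    by_cases hβ : ∃ l ∈ C, pair l.1 = some (u, x) ∧ l.2 = false
    · obtain ⟨l', hl', h2, h3⟩ := hβ
      have h4 := hω1 l' hl' _ h2 hne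
      rw [h3] at h4
      have h5 : β u x = true := decide_eq_true ⟨l', hl', h2, h3⟩
      rw [h5]
      simpa using h4
    · have h4 := hω1 l hl _ h1 hne
      have h5 : β u x = false := decide_eq_false hβ
      have h6 : l.2 = true := by
        by_contra h7
        exact hβ ⟨l, hl, h1, by simpa using h7⟩
      rw [h6] at h4
      rw [h5]
      simpa using h4
  refine (Finset.card_le_card hsub).trans (Finset.card_biUnion_le.trans ?_)
  calc ∑ u₀ : Fin (h + 1),
        (Fintype.piFinset fun u => if u = u₀ then Finset.univ else S u).card
      ≤ ∑ _u₀ : Fin (h + 1), N * 2 ^ N * (2 ^ N) ^ h := by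
        refine Finset.sum_le_sum fun u₀ _ => ?_
        rw [Fintype.card_piFinset]
        calc ∏ u, (if u = u₀ then Finset.univ else S u).card
            ≤ ∏ u, if u = u₀ then N * 2 ^ N else 2 ^ N := by
              refine Finset.prod_le_prod' fun u _ => ?_
              split_ifs
              · simp
              · exact card_selected_agreeing_le (M u) (β u)
          _ = N * 2 ^ N * (2 ^ N) ^ h := by
              rw [Finset.prod_ite, Finset.filter_eq', Finset.filter_ne']
              simp
    _ = (h + 1) * (N * 2 ^ N * (2 ^ N) ^ h) := by simp

/-- Refutations of the formula are long. -/
theorem pow_le_card (hh : 1 ≤ h) (hN : 1 ≤ N) {P : Finset (Clause (RelVar h N))}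
    (hP : DerivableWithin (relPHP h N) (· ∈ P) ∅) : N ^ h ≤ P.card * (h + 1) := by
  classical
  have hcover : (Finset.univ : Finset (Restriction h N)) ⊆
      P.biUnion fun C => Finset.univ.filter fun ω => IsWide ω C := by
    intro ω _
    obtain ⟨C, hC, hω⟩ := exists_isWide hh ω hP
    exact Finset.mem_biUnion.2 ⟨C, hC, Finset.mem_filter.2 ⟨Finset.mem_univ _, hω⟩⟩
  -- Union bound: the sets of restrictions for which the clauses of `P` are wide cover all `(N * 2 ^
  -- N) ^ (h + 1)` restrictions.
  have h1 := (Finset.card_le_card hcover).trans (Finset.card_biUnion_le.trans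
    (Finset.sum_le_card_nsmul P _ _ fun C _ => card_isWide_le C))
  simp only [Finset.card_univ, Fintype.card_pi, Fintype.card_prod, Fintype.card_fin,
    Fintype.card_bool, Finset.prod_const, smul_eq_mul] at h1
  have hpos : 0 < N * 2 ^ N * (2 ^ N) ^ h := by positivity
  refine Nat.le_of_mul_le_mul_right ?_ hpos
  calc N ^ h * (N * 2 ^ N * (2 ^ N) ^ h) = (N * 2 ^ N) ^ (h + 1) := by ring
    _ ≤ P.card * ((h + 1) * (N * 2 ^ N * (2 ^ N) ^ h)) := h1
    _ = P.card * (h + 1) * (N * 2 ^ N * (2 ^ N) ^ h) := by ring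

end relPHP

/-! ### Chains of implications -/

/-- The formula `x₀ ∧ (x₀ → x₁) ∧ … ∧ (x_{m-1} → x_m) ∧ ¬x_m`. -/
def implicationChain (m : ℕ) : CNF (Fin (m + 1)) :=
  insert {(0, true)} (insert {(Fin.last m, false)}
    ((Finset.univ : Finset (Fin m)).image fun i => {(i.castSucc, false), (i.succ, true)}))

namespace implicationChain

variable {m : ℕ}

theorem step_mem (i : Fin m) : {(i.castSucc, false), (i.succ, true)} ∈ implicationChain m :=
  Finset.mem_insert_of_mem (Finset.mem_insert_of_mem
    (Finset.mem_image_of_mem _ (Finset.mem_univ i)))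

theorem isKCNF : (implicationChain m).IsKCNF 3 := by
  intro C hC
  simp only [implicationChain, Finset.mem_insert, Finset.mem_image, Finset.mem_univ,
    true_and] at hC
  rcases hC with rfl | rfl | ⟨i, rfl⟩
  · simp
  · simp
  · exact Finset.card_le_two.trans (by norm_num)

theorem card_le : (implicationChain m).card ≤ m + 2 := by
  refine (Finset.card_insert_le _ _).trans (Nat.add_le_add_right
    ((Finset.card_insert_le _ _).trans (Nat.add_le_add_right Finset.card_image_le 1)) 1) |>.trans ?_
  simp

theorem derivable_empty :
    DerivableWithin (implicationChain m) (fun C => C.card ≤ 2) ∅ := by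
  have key : ∀ j, DerivableWithin (implicationChain m) (fun C => C.card ≤ 2) {(j, true)} := by
    intro j
    induction j using Fin.induction with
    | zero => exact .ax _ (Finset.mem_insert_self _ _) (by simp)
    | succ j ih =>
      refine .res j.castSucc _ _ _ ih (.ax _ (step_mem j) Finset.card_le_two) (by simp)
        (Finset.erase_insert_subset _ _) (by simp)
  exact .res (Fin.last m) _ _ _ (key (Fin.last m))
    (.ax _ (Finset.mem_insert_of_mem (Finset.mem_insert_self _ _)) (by simp)) (by simp) (by simp)
    (by simp)

/-- Every refutation uses all implications. -/
theorem le_card {P : Finset (Clause (Fin (m + 1)))}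
    (hP : DerivableWithin (implicationChain m) (· ∈ P) ∅) : m ≤ P.card := by
  have hmem : ∀ i : Fin m, ({(i.castSucc, false), (i.succ, true)} : Clause (Fin (m + 1))) ∈ P := by
    intro i
    -- Setting exactly the variables up to `i` to true falsifies only the `i`-th implication.
    by_contra hi
    obtain ⟨l, hl, -⟩ := (hP.erase_input hi).sound (fun j => decide (j.val ≤ i.val)) (by
      intro C hC
      obtain ⟨hne, hC⟩ := Finset.mem_erase.1 hC
      simp only [implicationChain, Finset.mem_insert, Finset.mem_image, Finset.mem_univ,
        true_and] at hC
      rcases hC with rfl | rfl | ⟨k, rfl⟩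
      · simp
      · simp
      · have hki : k.val ≠ i.val := fun h => hne (by rw [Fin.ext h])
        rcases lt_or_gt_of_ne hki with h | h
        · refine ⟨(k.succ, true), by simp, ?_⟩
          simp only [Fin.val_succ, decide_eq_true_eq]
          omega
        · refine ⟨(k.castSucc, false), by simp, ?_⟩
          simp only [Fin.val_castSucc, decide_eq_false_iff_not]
          omega)
    simp at hl
  have hinj : Function.Injective
      (fun i : Fin m => ({(i.castSucc, false), (i.succ, true)} : Clause (Fin (m + 1)))) := by
    intro i k hik
    have : (i.castSucc, false) ∈ ({(k.castSucc, false), (k.succ, true)} : Clause (Fin (m + 1))) := by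
      refine (Finset.ext_iff.1 hik _).1 ?_
      exact Finset.mem_insert_self _ _
    simpa using this
  calc m = ((Finset.univ : Finset (Fin m)).image
        fun i => ({(i.castSucc, false), (i.succ, true)} : Clause (Fin (m + 1)))).card := by
        rw [Finset.card_image_of_injective _ hinj]; simp
    _ ≤ P.card := Finset.card_le_card fun C hC => by
        obtain ⟨i, -, rfl⟩ := Finset.mem_image.1 hC
        exact hmem i

end implicationChain

/-! ### The main theorem -/

/-- For small widths, chains of implications need at least `√n` steps. -/
theorem exists_formula_small_width {n w : ℕ} (hn : 9 ≤ n) (hw : 2 ≤ w) :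
    ∃ F : CNF (Fin n), F.IsKCNF 3 ∧ F.card ≤ 8 * (w * n) ∧ RefutableInWidth F w ∧
      ∀ (S : CDCLSolver (Fin n)) (T : ℕ), S.CanRefuteInTime F T →
        (n : ℝ) ^ (1 / 2 : ℝ) ≤ (T : ℝ) := by
  obtain ⟨m, rfl⟩ : ∃ m, n = m + 1 := ⟨n - 1, by omega⟩
  refine ⟨implicationChain m, implicationChain.isKCNF, implicationChain.card_le.trans ?_,
    (implicationChain.derivable_empty.mono fun C hC => le_trans hC hw).refutableInWidth, ?_⟩
  · nlinarith
  · intro S T hT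
    obtain ⟨P, hP, hP'⟩ := hT.exists_derivation
    have h1 : (m : ℝ) ≤ 2 * T := by exact_mod_cast (implicationChain.le_card hP').trans hP
    have hm : (8 : ℝ) ≤ m := by exact_mod_cast (by omega : 8 ≤ m)
    rw [← Real.sqrt_eq_rpow]
    refine Real.sqrt_le_iff.2 ⟨by positivity, ?_⟩
    push_cast
    -- `T ≥ m / 2` and `m ≥ 8` give `T ^ 2 ≥ m ^ 2 / 4 ≥ m + 1`.
    nlinarith

/-- For larger widths, the formula `relPHP` needs many steps. -/
theorem exists_formula_pow_le {n h N : ℕ} (hh : 1 ≤ h) (hN : 1 ≤ N)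
    (hn : 7 * ((h + 1) ^ 2 * N ^ 2) ≤ n) :
    ∃ F : CNF (Fin n), F.IsKCNF 3 ∧ F.card ≤ 8 * ((h + 1) * n) ∧ RefutableInWidth F (2 * h + 5) ∧
      ∀ (S : CDCLSolver (Fin n)) (T : ℕ), S.CanRefuteInTime F T → N ^ h ≤ 2 * T * (h + 1) := by
  obtain ⟨e⟩ := RelVar.exists_embedding hN hn
  have : Nonempty (RelVar h N) := ⟨.p (0, ⟨0, hN⟩)⟩
  refine ⟨(relPHP h N).image fun C => C.image (Prod.map e id), ?_, ?_, ?_, ?_⟩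
  · intro C hC
    obtain ⟨D, hD, rfl⟩ := Finset.mem_image.1 hC
    exact Finset.card_image_le.trans (relPHP.isKCNF D hD)
  · refine Finset.card_image_le.trans ((relPHP.card_le hN).trans ?_)
    exact Nat.mul_le_mul_left _ (Nat.mul_le_mul_left _ (by omega))
  · have := (relPHP.derivable_empty hh hN).map e (Q := fun C => C.card ≤ 2 * h + 5)
      fun C hC => Finset.card_image_le.trans hC
    rw [Finset.image_empty] at this
    exact this.refutableInWidth
  · intro S T hT
    obtain ⟨P, hP, hP'⟩ := hT.exists_derivation
    -- The refutation is pulled back along a left inverse of `e`; variables outside the range go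
    -- anywhere, and the number of clauses does not increase.
    have h1 := hP'.map (Function.invFun e)
      (Q := (· ∈ P.image fun C => C.image (Prod.map (Function.invFun e) id)))
      fun C hC => Finset.mem_image_of_mem _ hC
    have hinv : ∀ C : Clause (RelVar h N),
        (C.image (Prod.map e id)).image (Prod.map (Function.invFun e) id) = C := by
      intro C
      rw [Finset.image_image, Prod.map_comp_map, Function.invFun_comp e.injective]
      simp
    rw [Finset.image_empty, Finset.image_image] at h1
    simp only [Function.comp_def, hinv, Finset.image_id'] at h1
    exact (relPHP.pow_le_card hh hN h1).trans
      (Nat.mul_le_mul_right _ (Finset.card_image_le.trans hP))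

/-- For widths between `8` and `n ^ a`, some formula needs at least `n ^ (c * w)` steps. -/
theorem exists_formula_large_width {a : ℝ} {n w : ℕ} (ha : a < 1 / 2) (hn : 1 ≤ n)
    (hn8 : (8 : ℝ) ≤ (n : ℝ) ^ ((1 / 2 - a) / 2)) (hw : 8 ≤ w) (hwn : (w : ℝ) ≤ (n : ℝ) ^ a) :
    ∃ F : CNF (Fin n), F.IsKCNF 3 ∧ F.card ≤ 8 * (w * n) ∧ RefutableInWidth F w ∧
      ∀ (S : CDCLSolver (Fin n)) (T : ℕ), S.CanRefuteInTime F T →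
        (n : ℝ) ^ ((1 / 2 - a) / 32 * w) ≤ (T : ℝ) := by
  have hn0 : (0 : ℝ) < n := by exact_mod_cast hn
  have hn1 : (1 : ℝ) ≤ n := by exact_mod_cast hn
  set δ : ℝ := 1 / 2 - a with hδ
  have hδ0 : 0 < δ := by linarith
  -- Then `2 * h + 5 ≤ 4 * (h + 1) ≤ w`, and `4 * (h + 1) * N ≤ n ^ a * n ^ δ = √n` for the `N`
  -- below.
  obtain ⟨h, hh⟩ : ∃ h, w / 4 = h + 1 := ⟨w / 4 - 1, by omega⟩
  have hh1 : 1 ≤ h := by omega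
  set N : ℕ := ⌊(n : ℝ) ^ δ⌋₊ with hNdef
  have hδ1 : (1 : ℝ) ≤ (n : ℝ) ^ δ := Real.one_le_rpow hn1 hδ0.le
  have hN : 1 ≤ N := Nat.one_le_floor_iff _ |>.2 hδ1
  have hNle : (N : ℝ) ≤ (n : ℝ) ^ δ := Nat.floor_le (by positivity)
  have hNge : (n : ℝ) ^ δ ≤ 2 * N := by
    have h1 := Nat.lt_floor_add_one ((n : ℝ) ^ δ)
    have h2 : (1 : ℝ) ≤ N := by exact_mod_cast hN
    rw [← hNdef] at h1
    linarith
  have hsize : 7 * ((h + 1) ^ 2 * N ^ 2) ≤ n := by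
    have h4 : (4 : ℝ) * (h + 1) ≤ w := by exact_mod_cast (by omega : 4 * (h + 1) ≤ w)
    have h1 : (4 : ℝ) * (h + 1) * N ≤ (n : ℝ) ^ (1 / 2 : ℝ) := by
      calc (4 : ℝ) * (h + 1) * N ≤ (n : ℝ) ^ a * (n : ℝ) ^ δ :=
            mul_le_mul (h4.trans hwn) hNle (by positivity) (by positivity)
        _ = (n : ℝ) ^ (1 / 2 : ℝ) := by rw [← Real.rpow_add hn0]; congr 1; rw [hδ]; ring
    have h2 : ((4 : ℝ) * (h + 1) * N) ^ 2 ≤ n := by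
      calc ((4 : ℝ) * (h + 1) * N) ^ 2 ≤ ((n : ℝ) ^ (1 / 2 : ℝ)) ^ 2 :=
            pow_le_pow_left₀ (by positivity) h1 2
        _ = n := by rw [← Real.sqrt_eq_rpow, Real.sq_sqrt hn0.le]
    have h3 : (7 : ℝ) * ((h + 1) ^ 2 * N ^ 2) ≤ n := by
      refine le_trans ?_ h2
      have : (0 : ℝ) ≤ (h + 1) ^ 2 * N ^ 2 := by positivity
      nlinarith
    exact_mod_cast h3
  obtain ⟨F, hF1, hF2, hF3, hF4⟩ := exists_formula_pow_le hh1 hN hsize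
  refine ⟨F, hF1, hF2.trans ?_, ?_, ?_⟩
  · exact Nat.mul_le_mul_left _ (Nat.mul_le_mul_right _ (by omega))
  · obtain ⟨π, h1, h2⟩ := hF3
    exact ⟨π, h1, fun C hC => (h2 C hC).trans (by omega)⟩
  · intro S T hT
    have h1 : (N : ℝ) ^ h ≤ 2 * T * (h + 1) := by exact_mod_cast hF4 S T hT
    have h2 : (2 : ℝ) * (h + 1) ≤ 4 ^ h := by
      have : ∀ k : ℕ, 2 * (k + 1 + 1) ≤ 4 ^ (k + 1) := by
        intro k
        induction k with
        | zero => norm_num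
        | succ k ih => rw [pow_succ]; omega
      have := this (h - 1)
      rw [Nat.sub_add_cancel hh1] at this
      exact_mod_cast this
    -- Half of the exponent absorbs the losses: `2 ^ h` from rounding `N`, and `4 ^ h` for the
    -- factor `2 * (h + 1)`.
    have hpow : ((n : ℝ) ^ (δ / 2)) ^ h * ((n : ℝ) ^ (δ / 2)) ^ h ≤
        ((n : ℝ) ^ (δ / 2)) ^ h * T := by
      calc ((n : ℝ) ^ (δ / 2)) ^ h * ((n : ℝ) ^ (δ / 2)) ^ h = ((n : ℝ) ^ δ) ^ h := by
            rw [← mul_pow, ← Real.rpow_add hn0, add_halves]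
        _ ≤ (2 * N) ^ h := pow_le_pow_left₀ (by positivity) hNge h
        _ = 2 ^ h * N ^ h := mul_pow _ _ _
        _ ≤ 2 ^ h * (2 * T * (h + 1)) := by gcongr
        _ = 2 ^ h * (2 * (h + 1)) * T := by ring
        _ ≤ 2 ^ h * 4 ^ h * T := by gcongr
        _ = 8 ^ h * T := by rw [← mul_pow]; norm_num
        _ ≤ ((n : ℝ) ^ (δ / 2)) ^ h * T := by gcongr
    have hT' := le_of_mul_le_mul_left hpow (by positivity)
    refine le_trans ?_ hT'
    rw [← Real.rpow_natCast, ← Real.rpow_mul hn0.le]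
    refine Real.rpow_le_rpow_of_exponent_le hn1 ?_
    have hwh : (w : ℝ) ≤ 16 * h := by exact_mod_cast (by omega : w ≤ 16 * h)
    nlinarith

/-- The first part of the main theorem. -/
theorem exists_formula_rpow_le (a : ℝ) (ha : a < 1 / 2) :
    ∃ c : ℝ, 0 < c ∧ ∃ K : ℝ, ∃ n₀ : ℕ, ∀ n : ℕ, n₀ ≤ n →
      ∀ w : ℕ, 2 ≤ w → (w : ℝ) ≤ (n : ℝ) ^ a →
        ∃ F : CNF (Fin n), F.IsKCNF 3 ∧ (F.card : ℝ) ≤ K * w * n ∧ RefutableInWidth F w ∧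
          ∀ (S : CDCLSolver (Fin n)) (T : ℕ), S.CanRefuteInTime F T →
            (n : ℝ) ^ (c * w) ≤ (T : ℝ) := by
  have hδ0 : 0 < (1 / 2 - a) / 2 := by linarith
  obtain ⟨n₁, hn₁⟩ := Filter.eventually_atTop.1 (((tendsto_rpow_atTop hδ0).comp
    tendsto_natCast_atTop_atTop).eventually_ge_atTop 8)
  -- The bound `1 / 16` keeps `c * w ≤ 1 / 2` for `w < 8`, as the implication chain requires.
  refine ⟨min ((1 / 2 - a) / 32) (1 / 16), lt_min (by linarith) (by norm_num), 8, max n₁ 9, ?_⟩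
  intro n hn w hw hwn
  have hn9 : 9 ≤ n := (le_max_right _ _).trans hn
  have hn1 : (1 : ℝ) ≤ n := by exact_mod_cast (by omega : 1 ≤ n)
  rcases Nat.lt_or_ge w 8 with h8 | h8
  · obtain ⟨F, h1, h2, h3, h4⟩ := exists_formula_small_width hn9 hw
    refine ⟨F, h1, ?_, h3, fun S T hT => le_trans ?_ (h4 S T hT)⟩
    · rw [mul_assoc]; exact_mod_cast h2
    · refine Real.rpow_le_rpow_of_exponent_le hn1 ?_
      have hw8 : (w : ℝ) ≤ 8 := by exact_mod_cast h8.le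
      calc min ((1 / 2 - a) / 32) (1 / 16) * (w : ℝ) ≤ 1 / 16 * 8 :=
            mul_le_mul (min_le_right _ _) hw8 (by positivity) (by norm_num)
        _ = 1 / 2 := by norm_num
  · obtain ⟨F, h1, h2, h3, h4⟩ := exists_formula_large_width ha (by omega)
      (hn₁ n ((le_max_left _ _).trans hn)) h8 hwn
    refine ⟨F, h1, ?_, h3, fun S T hT => le_trans ?_ (h4 S T hT)⟩
    · rw [mul_assoc]; exact_mod_cast h2
    · refine Real.rpow_le_rpow_of_exponent_le hn1 ?_
      exact mul_le_mul_of_nonneg_right (min_le_left _ _) (by positivity)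

theorem mainTheorem6 :
    (∀ a : ℝ, a < 1 / 2 → ∃ c : ℝ, 0 < c ∧ ∃ K : ℝ, ∃ n₀ : ℕ, ∀ n : ℕ, n₀ ≤ n →
      ∀ w : ℕ, 2 ≤ w → (w : ℝ) ≤ (n : ℝ) ^ a →
        ∃ F : CNF (Fin n), F.IsKCNF 3 ∧ (F.card : ℝ) ≤ K * w * n ∧ RefutableInWidth F w ∧
          ∀ (S : CDCLSolver (Fin n)) (T : ℕ), S.CanRefuteInTime F T →
            (n : ℝ) ^ (c * w) ≤ (T : ℝ)) ∧
    (∃ c : ℝ, 0 < c ∧ ∀ w : ℕ, 2 ≤ w → ∀ (S : (n : ℕ) → CDCLSolver (Fin n)) (K g : ℝ) (n₀ : ℕ),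
      (∀ n : ℕ, n₀ ≤ n → ∀ F : CNF (Fin n), F.IsKCNF 3 → RefutableInWidth F w →
        ∃ T : ℕ, (S n).CanRefuteInTime F T ∧ (T : ℝ) ≤ K * (n : ℝ) ^ g) →
      c * w ≤ g) := by
  refine ⟨exists_formula_rpow_le, ?_⟩
  -- Any `a` strictly between `0` and `1 / 2` would do: each fixed `w` is eventually at most `n ^
  -- a`, and `c` does not depend on `w`.
  obtain ⟨c, hc, K', n₁, hmain⟩ := exists_formula_rpow_le (1 / 4) (by norm_num)
  refine ⟨c, hc, fun w hw S K g n₀ hS => ?_⟩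
  by_contra hcon
  push Not at hcon
  -- If `g < c * w`, then `n ^ (c * w - g)` eventually exceeds `K`.
  have e1 := ((tendsto_rpow_atTop (sub_pos.2 hcon)).comp
    tendsto_natCast_atTop_atTop).eventually_gt_atTop K
  have e2 := ((tendsto_rpow_atTop (by norm_num : (0 : ℝ) < 1 / 4)).comp
    tendsto_natCast_atTop_atTop).eventually_ge_atTop (w : ℝ)
  obtain ⟨n, ⟨⟨⟨h1, h2⟩, h3⟩, h4⟩, h5⟩ := ((((e1.and e2).and (Filter.eventually_ge_atTop n₀)).and
    (Filter.eventually_ge_atTop n₁)).and (Filter.eventually_ge_atTop 1)).exists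
  have hn0 : (0 : ℝ) < n := by exact_mod_cast h5
  obtain ⟨F, hF1, -, hF3, hF4⟩ := hmain n h4 w hw h2
  obtain ⟨T, hT, hTle⟩ := hS n h3 F hF1 hF3
  have h6 := (hF4 (S n) T hT).trans hTle
  have h7 : K * (n : ℝ) ^ g < (n : ℝ) ^ (c * w - g) * (n : ℝ) ^ g :=
    mul_lt_mul_of_pos_right h1 (Real.rpow_pos_of_pos hn0 _)
  rw [← Real.rpow_add hn0, sub_add_cancel] at h7
  exact absurd h6 (not_le.2 h7)
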